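/- Let $d=2^n$ with $n\ge 1$. A Pauli channel is a map $\mathcal P_p(\rho)=\sum_{P\in\{I,X,Y,Z\}^{\otimes n}}p(P)\,P\rho P$ on $\mathbb C^{d\times d}$, with $p$ a probability distribution. A non-adaptive ancilla-free strategy with incoherent measurements fixes in advance a number $N$ of steps and, for each step $t\in\{1,\dots,N\}$, an input state $\rho_t$ on $\mathbb C^d$, a number $m_t\ge 1$ of channel uses, unital quantum channels $\mathcal N^t_1,\dots,\mathcal N^t_{m_t-1}$ on $\mathbb C^{d\times d}$, and a finite POVM $\mathcal M_t$ on $\mathbb C^d$. In step $t$ the state $\mathcal P\circ\mathcal N^t_{m_t-1}\circ\mathcal P\circ\cdots\circ\mathcal N^t_1\circ\mathcal P(\rho_t)$ is measured with $\mathcal M_t$, independently for different $t$. From the $N$ outcomes the strategy outputs a (possibly randomized) estimate $\hat{\mathcal P}$, which is a Pauli channel. It learns Pauli channels to accuracy $\varepsilon$ if for every Pauli channel $\mathcal P$ one has $\|\mathcal P-\hat{\mathcal P}\|_\diamond\le\varepsilon$ with probability at least $2/3$, where $\|\Phi\|_\diamond=\max_{\|\phi\|=1}\|(\mathrm{id}_d\otimes\Phi)(|\phi\rangle\langle\phi|)\|_1$.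 **Theorem.** There is a universal constant $c>0$ such that for all $n\ge1$ and $0<\varepsilon\le 1/4$, every such strategy that learns Pauli channels to accuracy $\varepsilon$ satisfies $$N\ge c\,\frac{d^3}{\varepsilon^2}\qquad\text{or}\qquad \sum_{t=1}^N m_t\ge c\,\frac{d^4}{\varepsilon^6}.$$ The bound on the number of measurements is optimal up to a logarithmic factor: there is a universal constant $C>0$ such that for all $n\ge1$ and $0<\varepsilon\le1/4$ some such strategy with $m_t=1$ for every $t$ learns Pauli channels to accuracy $\varepsilon$ with $N\le C\,d^3\log(d)/\varepsilon^2$ (this is the guarantee of the Flammia–Wallman protocol). -/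

import Mathlib

open scoped ComplexOrder

noncomputable section

/-- The index set of the computational basis of `n` qubits; it has `d = 2 ^ n` elements. -/
abbrev Qubits (n : ℕ) : Type := Fin n → Fin 2

/-- The complex `d × d` matrices, `d = 2 ^ n`. -/
abbrev QMat (n : ℕ) : Type := Matrix (Qubits n) (Qubits n) ℂ

/-- A quantum channel: a linear map with a Kraus representation. -/
def IsQuantumChannel {n : ℕ} (Φ : QMat n →ₗ[ℂ] QMat n) : Prop :=
  ∃ (r : ℕ) (A : Fin r → QMat n),
    ∑ k, (A k).conjTranspose * A k = 1 ∧ ∀ ρ, Φ ρ = ∑ k, A k * ρ * (A k).conjTranspose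

/-- A unital quantum channel. -/
def IsUnitalChannel {n : ℕ} (Φ : QMat n →ₗ[ℂ] QMat n) : Prop :=
  IsQuantumChannel Φ ∧ Φ 1 = 1

/-- The Schatten `1`-norm `tr √(Mᴴ M)`. -/
def traceNorm {ι : Type} [Fintype ι] [DecidableEq ι] (M : Matrix ι ι ℂ) : ℝ :=
  (cfc Real.sqrt (M.conjTranspose * M)).trace.re

/-- The map `id_d ⊗ Φ`: it applies `Φ` to each of the blocks of a `d² × d²` matrix. -/
def idTensor {n : ℕ} (Φ : QMat n →ₗ[ℂ] QMat n)
    (X : Matrix (Qubits n × Qubits n) (Qubits n × Qubits n) ℂ) :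
    Matrix (Qubits n × Qubits n) (Qubits n × Qubits n) ℂ :=
  Matrix.of fun a b => Φ (Matrix.of fun i j => X (a.1, i) (b.1, j)) a.2 b.2

/-- The diamond distance: the supremum of `‖(id_d ⊗ (Φ - Ψ)) (|φ⟩⟨φ|)‖₁` over the unit vectors
`φ` of `ℂ^d ⊗ ℂ^d`. -/
def diamondDist {n : ℕ} (Φ Ψ : QMat n →ₗ[ℂ] QMat n) : ℝ :=
  sSup {r : ℝ | ∃ φ : EuclideanSpace ℂ (Qubits n × Qubits n), ‖φ‖ = 1 ∧
    r = traceNorm (idTensor (Φ - Ψ) (Matrix.vecMulVec (fun a => φ a) (fun a => star (φ a))))}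

/-- The single-qubit Pauli matrices `I, X, Y, Z`. -/
def pauliMatrix : Fin 4 → Matrix (Fin 2) (Fin 2) ℂ :=
  ![!![1, 0; 0, 1], !![0, 1; 1, 0], !![0, -Complex.I; Complex.I, 0], !![1, 0; 0, -1]]

/-- Labels of the `n`-qubit Pauli operators `{I, X, Y, Z}^{⊗ n}`. -/
abbrev PauliLabel (n : ℕ) : Type := Fin n → Fin 4

/-- The `n`-qubit Pauli operator `P_{s 0} ⊗ ⋯ ⊗ P_{s (n-1)}`, by its entries. -/
def pauliOp {n : ℕ} (s : PauliLabel n) : QMat n :=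
  Matrix.of fun a b => ∏ k, pauliMatrix (s k) (a k) (b k)

/-- Probability distributions on the `n`-qubit Pauli operators. -/
abbrev PauliDist (n : ℕ) : Type := stdSimplex ℝ (PauliLabel n)

/-- The Pauli channel `ρ ↦ ∑_P p(P) P ρ P`. -/
def pauliChannel {n : ℕ} (p : PauliDist n) : QMat n →ₗ[ℂ] QMat n :=
  ∑ s, ((p.1 s : ℝ) : ℂ) • (LinearMap.mulLeft ℂ (pauliOp s) ∘ₗ LinearMap.mulRight ℂ (pauliOp s))

/-- A non-adaptive ancilla-free strategy with incoherent measurements. Everything except the final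
estimate is fixed before any outcome is observed. -/
structure NonadaptiveStrategy (n : ℕ) where
  /-- The number `N` of steps, which is the number of measurements. -/
  steps : ℕ
  /-- The input states. -/
  input : Fin steps → QMat n
  input_posSemidef : ∀ t, (input t).PosSemidef
  input_trace : ∀ t, (input t).trace = 1
  /-- The channels interleaved between consecutive uses of the unknown channel, in the order in
  which they are applied. -/
  interleaved : Fin steps → List (QMat n →ₗ[ℂ] QMat n)
  interleaved_unital : ∀ t, ∀ Φ ∈ interleaved t, IsUnitalChannel Φ
  /-- The number of outcomes of the measurement of each step. -/
  outcomes : Fin steps → ℕ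
  /-- The measurements. -/
  povm : (t : Fin steps) → Fin (outcomes t) → QMat n
  povm_posSemidef : ∀ t i, (povm t i).PosSemidef
  povm_sum : ∀ t, ∑ i, povm t i = 1
  /-- The (possibly randomized) estimate produced from the observed outcomes. -/
  estimate : ((t : Fin steps) → Fin (outcomes t)) → PMF (PauliDist n)

namespace NonadaptiveStrategy

variable {n : ℕ} (S : NonadaptiveStrategy n)

/-- The number `m_t ≥ 1` of uses of the unknown channel in step `t`. -/
def uses (t : Fin S.steps) : ℕ := (S.interleaved t).length + 1

/-- The state `(𝒫 ∘ 𝒩_{m_t - 1} ∘ 𝒫 ∘ ⋯ ∘ 𝒩_1 ∘ 𝒫) (ρ_t)` that is measured in step `t`. -/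
def output (P : QMat n →ₗ[ℂ] QMat n) (t : Fin S.steps) : QMat n :=
  (S.interleaved t).foldl (fun σ Φ => P (Φ σ)) (P (S.input t))

/-- The probability (Born's rule, independent steps) of the sequence `o` of outcomes when the
unknown channel is `P`. -/
def outcomeProb (P : QMat n →ₗ[ℂ] QMat n) (o : (t : Fin S.steps) → Fin (S.outcomes t)) : ℝ :=
  ∏ t, (S.output P t * S.povm t (o t)).trace.re

/-- The strategy solves Pauli channel tomography to accuracy `ε`: for every Pauli channel, the
Pauli channel that it outputs is `ε`-close in diamond distance with probability at least `2/3`. -/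
def LearnsPauli (ε : ℝ) : Prop :=
  ∀ p : PauliDist n,
    2 / 3 ≤ ∑ o, S.outcomeProb (pauliChannel p) o *
      ((S.estimate o).toOuterMeasure
        {q | diamondDist (pauliChannel p) (pauliChannel q) ≤ ε}).toReal

end NonadaptiveStrategy

end

/-!
Both halves are proved in a form without the second alternative and without the logarithm: every
learning strategy needs `c d³ / ε²` measurements, however often it uses the channel in a step, and
`C d³ / ε²` measurements suffice.

*Reduction to `ℓ¹`.* The diamond distance of two Pauli channels is the `ℓ¹` distance of their
distributions (`diamondDist_pauliChannel`): the input `φ` is mapped to a real combination of rank-one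
projections, and for the maximally entangled input these are orthogonal.

*Lower bound.* The Pauli labels are grouped in pairs, and the uniform distribution is perturbed by a
relative amount `± 4 ε`, with an independent sign for each pair and opposite signs within a pair. Two
members of this family that are both `ε`-close to a common channel have sign patterns that differ
in at most a quarter of the pairs, so that a guess made independently of the data is right with
probability `exp (- c d²)`. Hence the outcomes must carry `χ²`-information of order `d²` relative
to those of the depolarizing channel (`log_test_le_chiSq`). A channel of the family is the depolarizing
channel plus `4 ε Δ`, where `Δ` is a random signed sum of Pauli conjugations that annihilates the
identity. For a single use, the second moment of `tr (A Δ ρ)` is computed from the twirling identity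
(`sum_trace_mul_pauliMap_sq_le`). For several uses, the state entering the last one has
a traceless part of Hilbert–Schmidt norm at most `‖Δ ρ‖`, since unital channels contract this norm;
moving the last `Δ` to the observable bounds the deviation by `‖Δ A‖ ‖Δ ρ‖`, and `Δ` shrinks `A` and
`ρ` by a factor of order `d` by the Khinchine inequality (`sum_norm_pauliMap_sq_mul_le`). In both cases a step
carries information `O(ε² / d)` on average (`sum_chiSq_le`).

*Upper bound.* Symmetric matrices from the multiplication of the field with `2 ^ n` elements yield
`d + 1` stabilizer bases, in each of which a Pauli error shifts the first basis vector by a syndrome.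
The `d²` labels and the fibres of the syndromes form an affine plane (`existsUnique_syndrome_eq`), so
that the error rates are recovered from the `d + 1` syndrome distributions by a linear formula
(`sum_syndromeProb_syndrome`). Measuring each basis `24 d² / ε²` times makes the mean squared `ℓ¹`
error of the resulting estimate at most `ε² / 12`, and Chebyshev's inequality concludes
(`tomography_learnsPauli`).
-/

noncomputable section

/-! ### Trace norms of Hermitian matrices -/

lemma isHermitian_sum_smul_vecMulVec {ι κ : Type} [Fintype κ] (c : κ → ℝ) (v : κ → ι → ℂ) :
    (∑ s, (c s : ℂ) • Matrix.vecMulVec (v s) (star (v s))).IsHermitian := by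
  ext i j
  simp [Matrix.conjTranspose_apply, Matrix.sum_apply, Matrix.vecMulVec_apply, mul_comm]

section TraceNorm

variable {ι : Type} [Fintype ι] [DecidableEq ι]

lemma traceNorm_eq_sum_abs_eigenvalues {M : Matrix ι ι ℂ} (hM : M.IsHermitian) :
    traceNorm M = ∑ i, |hM.eigenvalues i| := by
  have hsa : IsSelfAdjoint M := hM.isSelfAdjoint
  have h1 : M.conjTranspose * M = cfc (fun x : ℝ => x ^ 2) M := by
    rw [cfc_pow_id (R := ℝ) M 2, hM.eq, sq]
  have h2 : cfc Real.sqrt (M.conjTranspose * M) = cfc (fun x : ℝ => |x|) M := by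
    rw [h1, ← cfc_comp' Real.sqrt (fun x : ℝ => x ^ 2) M (Real.continuous_sqrt.continuousOn)]
    simp only [Real.sqrt_sq_eq_abs]
  rw [traceNorm, h2, hM.cfc_eq, Matrix.IsHermitian.cfc, Unitary.conjStarAlgAut_apply,
    Matrix.trace_mul_cycle, Unitary.coe_star_mul_self, one_mul, Matrix.trace_diagonal]
  simp

lemma toEuclideanLin_eigenvectorBasis {M : Matrix ι ι ℂ} (hM : M.IsHermitian) (i : ι) :
    Matrix.toEuclideanLin M (hM.eigenvectorBasis i)
      = (hM.eigenvalues i : ℂ) • hM.eigenvectorBasis i := by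
  ext j
  have := congrFun (hM.mulVec_eigenvectorBasis i) j
  simpa [Matrix.toLpLin_apply] using this

variable {κ : Type} [Fintype κ]

lemma toEuclideanLin_sum_smul_vecMulVec (c : κ → ℝ) (v : κ → EuclideanSpace ℂ ι)
    (x : EuclideanSpace ℂ ι) :
    Matrix.toEuclideanLin (∑ s, (c s : ℂ) • Matrix.vecMulVec (v s).ofLp (star (v s).ofLp)) x
      = ∑ s, ((c s : ℂ) * inner ℂ (v s) x) • v s := by
  ext j
  simp [Matrix.toLpLin_apply, Matrix.mulVec, dotProduct, Matrix.vecMulVec_apply,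
    PiLp.inner_apply, Finset.sum_mul, Finset.mul_sum, Finset.sum_apply]
  refine Finset.sum_congr rfl fun s _ => Finset.sum_congr rfl fun i _ => ?_
  ring

/-- The triangle inequality for the trace norm of a real combination of rank-one projections. -/
lemma traceNorm_sum_smul_vecMulVec_le (c : κ → ℝ) (v : κ → EuclideanSpace ℂ ι)
    (hv : ∀ s, ‖v s‖ = 1) :
    traceNorm (∑ s, (c s : ℂ) • Matrix.vecMulVec (v s).ofLp (star (v s).ofLp)) ≤ ∑ s, |c s| := by
  have hM := isHermitian_sum_smul_vecMulVec c (fun s => (v s).ofLp)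
  set M := ∑ s, (c s : ℂ) • Matrix.vecMulVec (v s).ofLp (star (v s).ofLp) with hMdef
  rw [traceNorm_eq_sum_abs_eigenvalues hM]
  have hact := toEuclideanLin_sum_smul_vecMulVec c v
  rw [← hMdef] at hact
  set e := hM.eigenvectorBasis
  have key : ∀ i, hM.eigenvalues i = ∑ s, c s * ‖inner ℂ (v s) (e i)‖ ^ 2 := by
    intro i
    have h1 : inner ℂ (e i) (Matrix.toEuclideanLin M (e i)) = (hM.eigenvalues i : ℂ) := by
      rw [toEuclideanLin_eigenvectorBasis hM i, inner_smul_right,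
        inner_self_eq_norm_sq_to_K, e.norm_eq_one]
      simp
    rw [hact, inner_sum] at h1
    have h2 : ((∑ s, c s * ‖inner ℂ (v s) (e i)‖ ^ 2 : ℝ) : ℂ) = (hM.eigenvalues i : ℂ) := by
      rw [← h1]
      push_cast
      refine Finset.sum_congr rfl fun s _ => ?_
      rw [inner_smul_right, mul_assoc, ← inner_conj_symm (e i) (v s), ← Complex.conj_mul']
      ring
    exact_mod_cast h2.symm
  calc ∑ i, |hM.eigenvalues i| ≤ ∑ i, ∑ s, |c s| * ‖inner ℂ (v s) (e i)‖ ^ 2 := by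
        refine Finset.sum_le_sum fun i _ => ?_
        rw [key i]
        refine (Finset.abs_sum_le_sum_abs _ _).trans (Finset.sum_le_sum fun s _ => ?_)
        rw [abs_mul, abs_of_nonneg (sq_nonneg ‖inner ℂ (v s) (e i)‖)]
    _ = ∑ s, |c s| := by
        rw [Finset.sum_comm]
        refine Finset.sum_congr rfl fun s _ => ?_
        rw [← Finset.mul_sum, e.sum_sq_norm_inner_left, hv s]
        simp

/-- If the rank-one projections are orthogonal, the weights are eigenvalues. -/
lemma sum_abs_le_traceNorm_sum_smul_vecMulVec (c : κ → ℝ) (v : κ → EuclideanSpace ℂ ι)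
    (hv : Orthonormal ℂ v) :
    ∑ s, |c s| ≤ traceNorm (∑ s, (c s : ℂ) • Matrix.vecMulVec (v s).ofLp (star (v s).ofLp)) := by
  classical
  have hM := isHermitian_sum_smul_vecMulVec c (fun s => (v s).ofLp)
  set M := ∑ s, (c s : ℂ) • Matrix.vecMulVec (v s).ofLp (star (v s).ofLp) with hMdef
  rw [traceNorm_eq_sum_abs_eigenvalues hM]
  have hact := toEuclideanLin_sum_smul_vecMulVec c v
  rw [← hMdef] at hact
  set e := hM.eigenvectorBasis
  have key : ∀ i s, |hM.eigenvalues i| * ‖inner ℂ (v s) (e i)‖ ^ 2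
      = |c s| * ‖inner ℂ (v s) (e i)‖ ^ 2 := by
    intro i s
    have h1 : inner ℂ (v s) (Matrix.toEuclideanLin M (e i))
        = (hM.eigenvalues i : ℂ) * inner ℂ (v s) (e i) := by
      rw [toEuclideanLin_eigenvectorBasis hM i, inner_smul_right]
    rw [hact, inner_sum] at h1
    have h2 : ∑ t, inner ℂ (v s) (((c t : ℂ) * inner ℂ (v t) (e i)) • v t)
        = (c s : ℂ) * inner ℂ (v s) (e i) := by
      simp only [inner_smul_right, orthonormal_iff_ite.mp hv]
      simp
    rw [h2] at h1
    have h3 := congrArg norm h1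
    rw [norm_mul, norm_mul, Complex.norm_real, Complex.norm_real, Real.norm_eq_abs,
      Real.norm_eq_abs] at h3
    rw [sq, ← mul_assoc, ← h3, mul_assoc]
  calc ∑ s, |c s| = ∑ s, ∑ i, |c s| * ‖inner ℂ (v s) (e i)‖ ^ 2 := by
        refine Finset.sum_congr rfl fun s _ => ?_
        rw [← Finset.mul_sum, e.sum_sq_norm_inner_left, hv.1 s]
        simp
    _ = ∑ i, |hM.eigenvalues i| * ∑ s, ‖inner ℂ (v s) (e i)‖ ^ 2 := by
        rw [Finset.sum_comm]
        refine Finset.sum_congr rfl fun i _ => ?_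
        rw [Finset.mul_sum]
        exact Finset.sum_congr rfl fun s _ => (key i s).symm
    _ ≤ ∑ i, |hM.eigenvalues i| := by
        refine Finset.sum_le_sum fun i _ => ?_
        have := hv.sum_inner_products_le (e i) (s := Finset.univ)
        rw [e.norm_eq_one] at this
        have h0 := abs_nonneg (hM.eigenvalues i)
        nlinarith

end TraceNorm

/-! ### Pauli operators -/

lemma pauliMatrix_star (s : Fin 4) (a b : Fin 2) :
    star (pauliMatrix s a b) = pauliMatrix s b a := by
  fin_cases s <;> fin_cases a <;> fin_cases b <;> simp [pauliMatrix]

/-- The Pauli matrices are complete: up to the factor `2` they resolve the swap. -/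
lemma sum_pauliMatrix_mul_pauliMatrix (a b c e : Fin 2) :
    ∑ s, pauliMatrix s a c * pauliMatrix s e b
      = if a = b ∧ c = e then 2 else 0 := by
  fin_cases a <;> fin_cases b <;> fin_cases c <;> fin_cases e <;>
    simp [pauliMatrix, Fin.sum_univ_four] <;> norm_num

lemma sum_pauliMatrix_orthogonal (s t : Fin 4) :
    ∑ b, ∑ a, star (pauliMatrix s b a) * pauliMatrix t b a = if s = t then 2 else 0 := by
  fin_cases s <;> fin_cases t <;> simp [pauliMatrix] <;> norm_num

lemma pauliMatrix_mul_self (s : Fin 4) : pauliMatrix s * pauliMatrix s = 1 := by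
  ext a b
  fin_cases s <;> fin_cases a <;> fin_cases b <;> simp [pauliMatrix]

variable {n : ℕ}

lemma prod_ite_two (p : Fin n → Prop) [DecidablePred p] [Decidable (∀ k, p k)] :
    ∏ k, (if p k then (2 : ℂ) else 0) = if ∀ k, p k then (2 : ℂ) ^ n else 0 := by
  split_ifs with h
  · simp [h]
  · push Not at h
    obtain ⟨k, hk⟩ := h
    exact Finset.prod_eq_zero (Finset.mem_univ k) (by simp [hk])

lemma pauliOp_conjTranspose (s : PauliLabel n) : (pauliOp s).conjTranspose = pauliOp s := by
  ext a b
  simp only [pauliOp, Matrix.conjTranspose_apply, Matrix.of_apply, star_prod, pauliMatrix_star]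

lemma pauliOp_mul_self (s : PauliLabel n) : pauliOp s * pauliOp s = 1 := by
  ext a b
  simp only [pauliOp, Matrix.mul_apply, Matrix.of_apply, ← Finset.prod_mul_distrib]
  rw [← Fintype.prod_sum (fun k c => pauliMatrix (s k) (a k) c * pauliMatrix (s k) c (b k))]
  have : ∀ k, ∑ c, pauliMatrix (s k) (a k) c * pauliMatrix (s k) c (b k)
      = if a k = b k then 1 else 0 := by
    intro k
    rw [← Matrix.mul_apply, pauliMatrix_mul_self, Matrix.one_apply]
  simp only [this, Matrix.one_apply, Finset.prod_ite_zero, Finset.prod_const_one, funext_iff,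
    Finset.mem_univ, true_imp_iff]

lemma sum_pauliOp_mul_pauliOp (a b c e : Qubits n) :
    ∑ s, pauliOp s a c * pauliOp s e b = if a = b ∧ c = e then (2 : ℂ) ^ n else 0 := by
  simp only [pauliOp, Matrix.of_apply, ← Finset.prod_mul_distrib]
  rw [← Fintype.prod_sum (fun k s => pauliMatrix s (a k) (c k) * pauliMatrix s (e k) (b k))]
  simp only [sum_pauliMatrix_mul_pauliMatrix, prod_ite_two, funext_iff, forall_and]

lemma sum_pauliOp_orthogonal (s t : PauliLabel n) :
    ∑ b, ∑ a, star (pauliOp s b a) * pauliOp t b a = if s = t then (2 : ℂ) ^ n else 0 := by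
  have h1 : ∀ b : Qubits n, ∑ a, star (pauliOp s b a) * pauliOp t b a
      = ∏ k, ∑ a, star (pauliMatrix (s k) (b k) a) * pauliMatrix (t k) (b k) a := by
    intro b
    rw [Fintype.prod_sum]
    simp only [pauliOp, Matrix.of_apply, star_prod, ← Finset.prod_mul_distrib]
  simp only [h1]
  rw [← Fintype.prod_sum
    (fun k b => ∑ a, star (pauliMatrix (s k) b a) * pauliMatrix (t k) b a)]
  simp only [sum_pauliMatrix_orthogonal, prod_ite_two, funext_iff]

/-- The linear map `X ↦ ∑_s c(s) P_s X P_s` for arbitrary real weights `c`. -/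
def pauliMap (c : PauliLabel n → ℝ) : QMat n →ₗ[ℂ] QMat n :=
  ∑ s, ((c s : ℝ) : ℂ) • (LinearMap.mulLeft ℂ (pauliOp s) ∘ₗ LinearMap.mulRight ℂ (pauliOp s))

lemma pauliChannel_eq_pauliMap (p : PauliDist n) : pauliChannel p = pauliMap p.1 := rfl

lemma pauliMap_apply (c : PauliLabel n → ℝ) (X : QMat n) :
    pauliMap c X = ∑ s, (c s : ℂ) • (pauliOp s * X * pauliOp s) := by
  simp [pauliMap, LinearMap.sum_apply, mul_assoc]

lemma pauliMap_sub (c c' : PauliLabel n → ℝ) :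
    pauliMap c - pauliMap c' = pauliMap fun s => c s - c' s := by
  ext1 X
  simp [pauliMap_apply, sub_smul]

/-- Averaging over all Pauli conjugations is the completely depolarizing map. -/
lemma sum_pauliOp_conj (X : QMat n) :
    ∑ s, pauliOp s * X * pauliOp s = ((2 : ℂ) ^ n * X.trace) • (1 : QMat n) := by
  ext a b
  have h : ∀ s : PauliLabel n, (pauliOp s * X * pauliOp s) a b
      = ∑ e, ∑ c, (pauliOp s a c * pauliOp s e b) * X c e := by
    intro s
    rw [Matrix.mul_apply]
    refine Finset.sum_congr rfl fun e _ => ?_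
    rw [Matrix.mul_apply, Finset.sum_mul]
    exact Finset.sum_congr rfl fun c _ => by ring
  simp only [Matrix.sum_apply, h]
  rw [Finset.sum_comm]
  have h2 : ∀ e, ∑ s, ∑ c, (pauliOp s a c * pauliOp s e b) * X c e
      = ∑ c, (if a = b ∧ c = e then (2 : ℂ) ^ n else 0) * X c e := by
    intro e
    rw [Finset.sum_comm]
    simp only [← Finset.sum_mul, sum_pauliOp_mul_pauliOp]
  simp only [h2, Matrix.smul_apply, Matrix.one_apply, Matrix.trace, Matrix.diag_apply]
  by_cases hab : a = b
  · simp [hab, Finset.mul_sum]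
  · simp [hab]

/-! ### The diamond distance of Pauli channels -/

/-- The vector `(1 ⊗ P_s) φ`. -/
def pauliVec (s : PauliLabel n) (φ : EuclideanSpace ℂ (Qubits n × Qubits n)) :
    EuclideanSpace ℂ (Qubits n × Qubits n) :=
  WithLp.toLp 2 fun a => ∑ c, pauliOp s a.2 c * φ (a.1, c)

lemma idTensor_pauliMap (c : PauliLabel n → ℝ) (φ : EuclideanSpace ℂ (Qubits n × Qubits n)) :
    idTensor (pauliMap c) (Matrix.vecMulVec (fun a => φ a) (fun a => star (φ a)))
      = ∑ s, (c s : ℂ) •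
        Matrix.vecMulVec (pauliVec s φ).ofLp (star (pauliVec s φ).ofLp) := by
  ext a b
  simp only [idTensor, Matrix.of_apply, pauliMap_apply, Matrix.sum_apply, Matrix.smul_apply,
    Matrix.vecMulVec_apply, pauliVec]
  refine Finset.sum_congr rfl fun s _ => ?_
  congr 1
  rw [Matrix.mul_apply]
  simp only [Matrix.mul_apply, Matrix.of_apply, Pi.star_apply, star_sum, star_mul',
    Finset.sum_mul, Finset.mul_sum]
  refine Finset.sum_congr rfl fun x _ => Finset.sum_congr rfl fun y _ => ?_
  have : star (pauliOp s b.2 x) = pauliOp s x b.2 := by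
    rw [← Matrix.conjTranspose_apply, pauliOp_conjTranspose]
  rw [this]
  ring

lemma norm_pauliVec (s : PauliLabel n) (φ : EuclideanSpace ℂ (Qubits n × Qubits n)) :
    ‖pauliVec s φ‖ = ‖φ‖ := by
  have hu : ∀ x : Qubits n → ℂ, ∑ a, ‖∑ c, pauliOp s a c * x c‖ ^ 2 = ∑ a, ‖x a‖ ^ 2 := by
    intro x
    have h : ∀ y : Qubits n → ℂ, ((∑ a, ‖y a‖ ^ 2 : ℝ) : ℂ) = star y ⬝ᵥ y := by
      intro y
      push_cast
      simp [dotProduct, Complex.conj_mul']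
    have h2 : star ((pauliOp s).mulVec x) ⬝ᵥ ((pauliOp s).mulVec x) = star x ⬝ᵥ x := by
      rw [Matrix.star_mulVec, pauliOp_conjTranspose, Matrix.dotProduct_mulVec,
        Matrix.vecMul_vecMul, pauliOp_mul_self, Matrix.vecMul_one]
    rw [← h, ← h] at h2
    exact_mod_cast h2
  rw [EuclideanSpace.norm_eq, EuclideanSpace.norm_eq, Fintype.sum_prod_type,
    Fintype.sum_prod_type]
  congr 1
  exact Finset.sum_congr rfl fun a _ => hu fun c => φ (a, c)

/-- The maximally entangled state `d^{-1/2} ∑_a |a⟩|a⟩`. -/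
def bellVec (n : ℕ) : EuclideanSpace ℂ (Qubits n × Qubits n) :=
  WithLp.toLp 2 fun a => if a.1 = a.2 then ((Real.sqrt (2 ^ n))⁻¹ : ℂ) else 0

lemma orthonormal_pauliVec_bellVec : Orthonormal ℂ fun s : PauliLabel n => pauliVec s (bellVec n) := by
  classical
  rw [orthonormal_iff_ite]
  intro s t
  have h1 : ∀ (s : PauliLabel n) (a : Qubits n × Qubits n),
      pauliVec s (bellVec n) a = pauliOp s a.2 a.1 * ((Real.sqrt (2 ^ n))⁻¹ : ℂ) := by
    intro s a
    simp [pauliVec, bellVec]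
  have h2 : ((Real.sqrt (2 ^ n) : ℝ) : ℂ) * (Real.sqrt (2 ^ n) : ℝ) = 2 ^ n := by
    rw [← Complex.ofReal_mul, Real.mul_self_sqrt (by positivity)]
    push_cast; rfl
  have h3 : inner ℂ (pauliVec s (bellVec n)) (pauliVec t (bellVec n))
      = (∑ b, ∑ a, star (pauliOp s b a) * pauliOp t b a) * ((2 : ℂ) ^ n)⁻¹ := by
    rw [PiLp.inner_apply, Fintype.sum_prod_type, Finset.sum_comm]
    simp only [h1, Finset.sum_mul]
    refine Finset.sum_congr rfl fun b _ => Finset.sum_congr rfl fun a _ => ?_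
    simp only [RCLike.inner_apply, map_mul, map_inv₀, Complex.conj_ofReal]
    rw [← h2, mul_inv, RCLike.star_def]
    ring
  rw [h3, sum_pauliOp_orthogonal]
  split_ifs <;> simp

lemma norm_bellVec : ‖bellVec n‖ = 1 := by
  rw [← norm_pauliVec 0]
  exact orthonormal_pauliVec_bellVec.1 0

/-- The diamond distance of Pauli channels is the `ℓ¹` distance of their distributions. -/
theorem diamondDist_pauliChannel (p q : PauliDist n) :
    diamondDist (pauliChannel p) (pauliChannel q) = ∑ s, |p.1 s - q.1 s| := by
  have hle : ∀ φ : EuclideanSpace ℂ (Qubits n × Qubits n), ‖φ‖ = 1 →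
      traceNorm (idTensor (pauliChannel p - pauliChannel q)
        (Matrix.vecMulVec (fun a => φ a) (fun a => star (φ a)))) ≤ ∑ s, |p.1 s - q.1 s| := by
    intro φ hφ
    rw [pauliChannel_eq_pauliMap, pauliChannel_eq_pauliMap, pauliMap_sub, idTensor_pauliMap]
    exact traceNorm_sum_smul_vecMulVec_le _ _ fun s => by rw [norm_pauliVec, hφ]
  apply le_antisymm
  · refine csSup_le ⟨_, bellVec n, norm_bellVec, rfl⟩ ?_
    rintro r ⟨φ, hφ, rfl⟩
    exact hle φ hφ
  · refine le_trans ?_ (le_csSup ⟨∑ s, |p.1 s - q.1 s|, ?_⟩ ⟨bellVec n, norm_bellVec, rfl⟩)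
    · rw [pauliChannel_eq_pauliMap, pauliChannel_eq_pauliMap, pauliMap_sub, idTensor_pauliMap]
      exact sum_abs_le_traceNorm_sum_smul_vecMulVec _ _ orthonormal_pauliVec_bellVec
    · rintro r ⟨φ, hφ, rfl⟩
      exact hle φ hφ

/-! ### Rademacher sums -/

/-- The sign `±1` encoded by a Boolean. -/
def boolSign (b : Bool) : ℝ := if b then 1 else -1

lemma abs_boolSign (b : Bool) : |boolSign b| = 1 := by cases b <;> simp [boolSign]

lemma sum_pi_fin_succ {M : ℕ} {R : Type*} [AddCommMonoid R] (f : (Fin (M + 1) → Bool) → R) :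
    ∑ β, f β = ∑ β : Fin M → Bool, (f (Fin.cons true β) + f (Fin.cons false β)) := by
  rw [← (Fin.consEquiv fun _ : Fin (M + 1) => Bool).sum_comp f, Fintype.sum_prod_type,
    Fintype.sum_bool, ← Finset.sum_add_distrib]
  rfl

section Rademacher

variable {𝕜 E : Type*} [RCLike 𝕜] [NormedAddCommGroup E] [InnerProductSpace 𝕜 E]

lemma sum_norm_sq_rademacher {M : ℕ} (v : Fin M → E) :
    ∑ β : Fin M → Bool, ‖∑ i, (boolSign (β i) : 𝕜) • v i‖ ^ 2 = 2 ^ M * ∑ i, ‖v i‖ ^ 2 := by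
  induction M with
  | zero => simp
  | succ M ih =>
    rw [sum_pi_fin_succ]
    simp only [Fin.sum_univ_succ, Fin.cons_zero, Fin.cons_succ]
    have h : ∀ S : E, ‖(boolSign true : 𝕜) • v 0 + S‖ ^ 2 + ‖(boolSign false : 𝕜) • v 0 + S‖ ^ 2
        = 2 * ‖v 0‖ ^ 2 + 2 * ‖S‖ ^ 2 := by
      intro S
      simp only [boolSign, if_true, Bool.false_eq_true, if_false, RCLike.ofReal_one, one_smul,
        neg_smul, norm_add_sq (𝕜 := 𝕜), norm_neg, inner_neg_left, map_neg]
      ring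
    simp only [h, Finset.sum_add_distrib, ← Finset.mul_sum, ih]
    simp
    ring

/-- The Khinchine inequality for fourth moments in an inner product space, with the constant `3`. -/
lemma sum_norm_pow_four_rademacher_le {M : ℕ} (v : Fin M → E) :
    ∑ β : Fin M → Bool, ‖∑ i, (boolSign (β i) : 𝕜) • v i‖ ^ 4
      ≤ 2 ^ M * (3 * (∑ i, ‖v i‖ ^ 2) ^ 2) := by
  induction M with
  | zero => simp
  | succ M ih =>
    rw [sum_pi_fin_succ]
    simp only [Fin.sum_univ_succ, Fin.cons_zero, Fin.cons_succ]
    have h : ∀ S : E, ‖(boolSign true : 𝕜) • v 0 + S‖ ^ 4 + ‖(boolSign false : 𝕜) • v 0 + S‖ ^ 4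
        ≤ 2 * ‖S‖ ^ 4 + 12 * ‖v 0‖ ^ 2 * ‖S‖ ^ 2 + 2 * ‖v 0‖ ^ 4 := by
      intro S
      have e : ∀ x : E, ‖x‖ ^ 4 = (‖x‖ ^ 2) ^ 2 := fun x => by ring
      have hi : (RCLike.re (inner 𝕜 (v 0) S)) ^ 2 ≤ ‖v 0‖ ^ 2 * ‖S‖ ^ 2 := by
        rw [← mul_pow, ← sq_abs]
        exact pow_le_pow_left₀ (abs_nonneg _)
          ((RCLike.abs_re_le_norm _).trans (norm_inner_le_norm _ _)) 2
      rw [e, e]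
      simp only [boolSign, if_true, Bool.false_eq_true, if_false, RCLike.ofReal_one, one_smul,
        neg_smul, norm_add_sq (𝕜 := 𝕜), norm_neg, inner_neg_left, map_neg]
      nlinarith
    refine (Finset.sum_le_sum fun β _ => h _).trans ?_
    simp only [Finset.sum_add_distrib, ← Finset.mul_sum, sum_norm_sq_rademacher]
    have := ih (fun i => v i.succ)
    simp only [Finset.sum_const, Finset.card_univ, Fintype.card_pi, Fintype.card_bool,
      Finset.prod_const, Fintype.card_fin, nsmul_eq_mul]
    push_cast
    have h0 : (0 : ℝ) ≤ 2 ^ M * ‖v 0‖ ^ 4 := by positivity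
    rw [pow_succ (2 : ℝ) M]
    nlinarith

end Rademacher

/-! ### The Hilbert–Schmidt norm -/

/-- A matrix as a vector of `ℂ^d ⊗ ℂ^d`; the norm of this vector is the Hilbert–Schmidt norm. -/
def hsVec : QMat n →ₗ[ℂ] EuclideanSpace ℂ (Qubits n × Qubits n) where
  toFun X := WithLp.toLp 2 fun a => X a.1 a.2
  map_add' _ _ := rfl
  map_smul' _ _ := rfl

lemma inner_hsVec (X Y : QMat n) :
    inner ℂ (hsVec X) (hsVec Y) = (X.conjTranspose * Y).trace := by
  simp only [hsVec, PiLp.inner_apply, RCLike.inner_apply,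
    Fintype.sum_prod_type, Matrix.trace, Matrix.diag_apply, Matrix.mul_apply,
    Matrix.conjTranspose_apply, RCLike.star_def]
  rw [Finset.sum_comm]
  exact Finset.sum_congr rfl fun _ _ => Finset.sum_congr rfl fun _ _ => mul_comm _ _

lemma norm_hsVec_sq (X : QMat n) : ((‖hsVec X‖ ^ 2 : ℝ) : ℂ) = (X.conjTranspose * X).trace := by
  rw [← inner_hsVec, inner_self_eq_norm_sq_to_K]
  push_cast
  rfl

lemma norm_hsVec_sq_eq_sum (X : QMat n) : ‖hsVec X‖ ^ 2 = ∑ a, ∑ b, ‖X a b‖ ^ 2 := by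
  rw [EuclideanSpace.norm_sq_eq, Fintype.sum_prod_type]
  rfl

lemma norm_trace_mul_le (X Y : QMat n) :
    ‖(X.conjTranspose * Y).trace‖ ≤ ‖hsVec X‖ * ‖hsVec Y‖ := by
  rw [← inner_hsVec]
  exact norm_inner_le_norm _ _

open scoped MatrixOrder in
lemma Matrix.PosSemidef.exists_conjTranspose_mul_self {A : QMat n} (hA : A.PosSemidef) :
    ∃ C : QMat n, A = C.conjTranspose * C := by
  obtain ⟨C, hC⟩ := CStarAlgebra.nonneg_iff_eq_star_mul_self.mp hA.nonneg
  exact ⟨C, hC⟩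

lemma Matrix.PosSemidef.norm_hsVec_le {A : QMat n} (hA : A.PosSemidef) : ‖hsVec A‖ ≤ A.trace.re := by
  obtain ⟨C, rfl⟩ := Matrix.PosSemidef.exists_conjTranspose_mul_self hA
  set c : Qubits n → EuclideanSpace ℂ (Qubits n) := fun j => WithLp.toLp 2 fun i => C i j with hc
  have hin : ∀ i j, (C.conjTranspose * C) i j = inner ℂ (c i) (c j) := by
    intro i j
    simp [hc, PiLp.inner_apply, Matrix.mul_apply, mul_comm]
  have htr : (C.conjTranspose * C).trace.re = ∑ i, ‖c i‖ ^ 2 := by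
    simp only [Matrix.trace, Matrix.diag_apply, hin, inner_self_eq_norm_sq_to_K, Complex.re_sum]
    refine Finset.sum_congr rfl fun i _ => ?_
    norm_cast
  rw [htr]
  refine abs_le_of_sq_le_sq' ?_ (by positivity) |>.2
  rw [norm_hsVec_sq_eq_sum, sq (∑ i, ‖c i‖ ^ 2), Finset.sum_mul_sum]
  refine Finset.sum_le_sum fun i _ => Finset.sum_le_sum fun j _ => ?_
  rw [hin, ← mul_pow]
  exact pow_le_pow_left₀ (norm_nonneg _) (norm_inner_le_norm _ _) 2

lemma Matrix.PosSemidef.trace_mul_re_nonneg {A B : QMat n} (hA : A.PosSemidef) (hB : B.PosSemidef) :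
    0 ≤ (A * B).trace.re := by
  obtain ⟨C, rfl⟩ := Matrix.PosSemidef.exists_conjTranspose_mul_self hB
  rw [← mul_assoc, Matrix.trace_mul_comm, ← mul_assoc]
  exact (Complex.nonneg_iff.mp (hA.mul_mul_conjTranspose_same C).trace_nonneg).1

lemma Matrix.PosSemidef.trace_mul_re_le {A B : QMat n} (hA : A.PosSemidef) (hB : B.PosSemidef) :
    (A * B).trace.re ≤ A.trace.re * B.trace.re := by
  have h := norm_trace_mul_le A B
  rw [hA.1.eq] at h
  calc (A * B).trace.re ≤ ‖(A * B).trace‖ := Complex.re_le_norm _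
    _ ≤ ‖hsVec A‖ * ‖hsVec B‖ := h
    _ ≤ _ := mul_le_mul (Matrix.PosSemidef.norm_hsVec_le hA) (Matrix.PosSemidef.norm_hsVec_le hB)
      (norm_nonneg _) (Complex.nonneg_iff.mp hA.trace_nonneg).1

/-! ### Quantum channels -/

lemma IsQuantumChannel.posSemidef {Φ : QMat n →ₗ[ℂ] QMat n} (hΦ : IsQuantumChannel Φ)
    {ρ : QMat n} (hρ : ρ.PosSemidef) : (Φ ρ).PosSemidef := by
  obtain ⟨r, A, -, h⟩ := hΦ
  rw [h]
  exact Matrix.posSemidef_sum _ fun k _ => hρ.mul_mul_conjTranspose_same (A k)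

lemma IsQuantumChannel.trace_apply {Φ : QMat n →ₗ[ℂ] QMat n} (hΦ : IsQuantumChannel Φ)
    (ρ : QMat n) : (Φ ρ).trace = ρ.trace := by
  obtain ⟨r, A, h1, h⟩ := hΦ
  rw [h, Matrix.trace_sum]
  simp only [fun k => Matrix.trace_mul_cycle (A k) ρ (A k).conjTranspose]
  rw [← Matrix.trace_sum, ← Finset.sum_mul, h1, one_mul]

/-- Unital channels contract the Hilbert–Schmidt norm. With Kraus operators `A_k` and `Y = Φ X`,
`‖Y‖² = ∑_k ⟨Y A_k, A_k X⟩ ≤ ½ ∑_k (‖Y A_k‖² + ‖A_k X‖²) = ½ (‖Y‖² + ‖X‖²)`. -/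
lemma IsUnitalChannel.norm_hsVec_le {Φ : QMat n →ₗ[ℂ] QMat n} (hΦ : IsUnitalChannel Φ)
    (X : QMat n) : ‖hsVec (Φ X)‖ ≤ ‖hsVec X‖ := by
  obtain ⟨⟨r, A, h1, h⟩, h2⟩ := hΦ
  have h2' : ∑ k, A k * (A k).conjTranspose = 1 := by rw [← h2, h]; simp
  set Y := Φ X with hY
  have e1 : ∑ k, ‖hsVec (Y * A k)‖ ^ 2 = ‖hsVec Y‖ ^ 2 := by
    have : ((∑ k, ‖hsVec (Y * A k)‖ ^ 2 : ℝ) : ℂ) = ((‖hsVec Y‖ ^ 2 : ℝ) : ℂ) := by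
      rw [Complex.ofReal_sum]
      simp only [norm_hsVec_sq, Matrix.conjTranspose_mul]
      have : ∀ k, ((A k).conjTranspose * Y.conjTranspose * (Y * A k)).trace
          = (Y.conjTranspose * Y * (A k * (A k).conjTranspose)).trace := by
        intro k
        rw [mul_assoc, Matrix.trace_mul_comm]
        simp only [mul_assoc]
      simp only [this]
      rw [← Matrix.trace_sum, ← Finset.mul_sum, h2', mul_one]
    exact_mod_cast this
  have e2 : ∑ k, ‖hsVec (A k * X)‖ ^ 2 = ‖hsVec X‖ ^ 2 := by
    have : ((∑ k, ‖hsVec (A k * X)‖ ^ 2 : ℝ) : ℂ) = ((‖hsVec X‖ ^ 2 : ℝ) : ℂ) := by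
      rw [Complex.ofReal_sum]
      simp only [norm_hsVec_sq, Matrix.conjTranspose_mul]
      have : ∀ k, (X.conjTranspose * (A k).conjTranspose * (A k * X)).trace
          = (X.conjTranspose * ((A k).conjTranspose * A k) * X).trace := by
        intro k
        simp only [mul_assoc]
      simp only [this]
      rw [← Matrix.trace_sum, ← Finset.sum_mul, ← Finset.mul_sum, h1, mul_one]
    exact_mod_cast this
  have e3 : ‖hsVec Y‖ ^ 2 = ∑ k, (((Y * A k).conjTranspose * (A k * X)).trace).re := by
    have : ((‖hsVec Y‖ ^ 2 : ℝ) : ℂ) = ∑ k, ((Y * A k).conjTranspose * (A k * X)).trace := by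
      rw [norm_hsVec_sq]
      nth_rewrite 2 [hY]
      rw [h, Finset.mul_sum, Matrix.trace_sum]
      refine Finset.sum_congr rfl fun k _ => ?_
      rw [← mul_assoc, Matrix.trace_mul_comm, Matrix.conjTranspose_mul]
      simp only [mul_assoc]
    rw [← Complex.re_sum, ← this, Complex.ofReal_re]
  have e4 : ‖hsVec Y‖ ^ 2 ≤ ∑ k, (‖hsVec (Y * A k)‖ ^ 2 + ‖hsVec (A k * X)‖ ^ 2) / 2 := by
    rw [e3]
    refine Finset.sum_le_sum fun k _ => ?_
    have := (Complex.re_le_norm _).trans (norm_trace_mul_le (Y * A k) (A k * X))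
    nlinarith [sq_nonneg (‖hsVec (Y * A k)‖ - ‖hsVec (A k * X)‖)]
  rw [← Finset.sum_div, Finset.sum_add_distrib, e1, e2] at e4
  exact abs_le_of_sq_le_sq' (by linarith) (norm_nonneg _) |>.2

lemma pauliChannel_isUnitalChannel (p : PauliDist n) : IsUnitalChannel (pauliChannel p) := by
  have hsum : ∑ s, (p.1 s : ℂ) = 1 := by
    have := p.2.2
    exact_mod_cast this
  have hsq : ∀ s, ((Real.sqrt (p.1 s) : ℝ) : ℂ) * (Real.sqrt (p.1 s) : ℝ) = (p.1 s : ℂ) := by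
    intro s
    rw [← Complex.ofReal_mul, Real.mul_self_sqrt (p.2.1 s)]
  refine ⟨⟨Fintype.card (PauliLabel n), fun k =>
    ((Real.sqrt (p.1 ((Fintype.equivFin _).symm k)) : ℝ) : ℂ) •
      pauliOp ((Fintype.equivFin (PauliLabel n)).symm k), ?_, fun ρ => ?_⟩, ?_⟩
  · rw [(Fintype.equivFin (PauliLabel n)).symm.sum_comp (fun s =>
      (((Real.sqrt (p.1 s) : ℝ) : ℂ) • pauliOp s).conjTranspose *
        (((Real.sqrt (p.1 s) : ℝ) : ℂ) • pauliOp s))]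
    simp only [Matrix.conjTranspose_smul, pauliOp_conjTranspose, RCLike.star_def,
      Complex.conj_ofReal, smul_mul_smul_comm, hsq, pauliOp_mul_self]
    rw [← Finset.sum_smul, hsum, one_smul]
  · rw [(Fintype.equivFin (PauliLabel n)).symm.sum_comp (fun s =>
      (((Real.sqrt (p.1 s) : ℝ) : ℂ) • pauliOp s) * ρ *
        (((Real.sqrt (p.1 s) : ℝ) : ℂ) • pauliOp s).conjTranspose)]
    simp only [Matrix.conjTranspose_smul, pauliOp_conjTranspose, RCLike.star_def,
      Complex.conj_ofReal, smul_mul_assoc, mul_smul_comm, smul_smul, hsq,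
      pauliChannel_eq_pauliMap, pauliMap_apply]
  · simp only [pauliChannel_eq_pauliMap, pauliMap_apply, mul_one, pauliOp_mul_self]
    rw [← Finset.sum_smul, hsum, one_smul]

/-! ### A random family of Pauli channels near the depolarizing channel -/

/-- Signed weights on the Pauli labels. The labels are grouped in `M` pairs by `e`, the sign `β i` is
attached to the first label of the pair `i` and its opposite to the second, so that the weights sum
to zero. -/
def pairWeight {M : ℕ} (e : Fin M × Bool ≃ PauliLabel n) (β : Fin M → Bool) (s : PauliLabel n) : ℝ :=
  boolSign (β (e.symm s).1) * boolSign (e.symm s).2 / 4 ^ n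

variable {M : ℕ} (e : Fin M × Bool ≃ PauliLabel n)

lemma sum_pairWeight (β : Fin M → Bool) : ∑ s, pairWeight e β s = 0 := by
  rw [← e.sum_comp, Fintype.sum_prod_type]
  refine Finset.sum_eq_zero fun i _ => ?_
  simp [pairWeight, boolSign]
  ring

lemma abs_pairWeight (β : Fin M → Bool) (s : PauliLabel n) : |pairWeight e β s| = 1 / 4 ^ n := by
  rw [pairWeight, abs_div, abs_mul, abs_boolSign, abs_boolSign, abs_of_pos (by positivity)]
  simp

/-- The probability distribution with density `1 + η α` relative to the uniform distribution, where
`α = ±1` is the sign pattern of `pairWeight`. -/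
def perturbDist {η : ℝ} (h0 : 0 ≤ η) (h1 : η ≤ 1) (β : Fin M → Bool) : PauliDist n :=
  ⟨fun s => 1 / 4 ^ n + η * pairWeight e β s, fun s => by
    have h := abs_pairWeight e β s
    have h2 := neg_abs_le (pairWeight e β s)
    have h3 := abs_nonneg (pairWeight e β s)
    rw [← h]
    nlinarith, by
    rw [Finset.sum_add_distrib, ← Finset.mul_sum, sum_pairWeight]
    simp⟩

lemma two_pow_mul_self (n : ℕ) : (2 : ℝ) ^ n * 2 ^ n = 4 ^ n := by
  rw [← mul_pow]; norm_num

lemma pauliChannel_perturbDist {η : ℝ} (h0 : 0 ≤ η) (h1 : η ≤ 1) (β : Fin M → Bool) (X : QMat n) :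
    pauliChannel (perturbDist e h0 h1 β) X
      = (X.trace / 2 ^ n) • (1 : QMat n) + (η : ℂ) • pauliMap (pairWeight e β) X := by
  rw [pauliChannel_eq_pauliMap, pauliMap_apply, pauliMap_apply]
  simp only [perturbDist, Complex.ofReal_add, add_smul, Finset.sum_add_distrib,
    Complex.ofReal_mul, mul_smul, ← Finset.smul_sum]
  rw [sum_pauliOp_conj, smul_smul]
  congr 2
  have : (4 : ℂ) ^ n = 2 ^ n * 2 ^ n := by rw [← mul_pow]; norm_num
  push_cast
  rw [this]
  field_simp

lemma pauliMap_pairWeight_one (β : Fin M → Bool) : pauliMap (pairWeight e β) 1 = 0 := by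
  rw [pauliMap_apply]
  simp only [mul_one, pauliOp_mul_self]
  rw [← Finset.sum_smul, ← Complex.ofReal_sum, sum_pairWeight]
  simp

/-- Conjugation by the first Pauli operator of the pair `i` minus conjugation by the second. -/
def pairMap (i : Fin M) (X : QMat n) : QMat n :=
  ((1 / 4 ^ n : ℝ) : ℂ) • (pauliOp (e (i, true)) * X * pauliOp (e (i, true))
    - pauliOp (e (i, false)) * X * pauliOp (e (i, false)))

lemma pauliMap_pairWeight (β : Fin M → Bool) (X : QMat n) :
    pauliMap (pairWeight e β) X = ∑ i, (boolSign (β i) : ℂ) • pairMap e i X := by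
  rw [pauliMap_apply, ← e.sum_comp, Fintype.sum_prod_type]
  refine Finset.sum_congr rfl fun i _ => ?_
  rw [Fintype.sum_bool]
  simp only [pairWeight, pairMap, Equiv.symm_apply_apply, boolSign]
  simp only [if_true, Bool.false_eq_true, if_false, smul_smul]
  push_cast
  module

lemma norm_hsVec_pauliOp_conj (s : PauliLabel n) (X : QMat n) :
    ‖hsVec (pauliOp s * X * pauliOp s)‖ = ‖hsVec X‖ := by
  have h : ‖hsVec (pauliOp s * X * pauliOp s)‖ ^ 2 = ‖hsVec X‖ ^ 2 := by
    have : ((‖hsVec (pauliOp s * X * pauliOp s)‖ ^ 2 : ℝ) : ℂ) = ((‖hsVec X‖ ^ 2 : ℝ) : ℂ) := by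
      rw [norm_hsVec_sq, norm_hsVec_sq]
      simp only [Matrix.conjTranspose_mul, pauliOp_conjTranspose]
      rw [Matrix.trace_mul_comm]
      have e1 : pauliOp s * X * pauliOp s * (pauliOp s * (X.conjTranspose * pauliOp s))
          = pauliOp s * (X * (pauliOp s * pauliOp s) * X.conjTranspose * pauliOp s) := by
        simp only [mul_assoc]
      rw [e1, pauliOp_mul_self, mul_one, Matrix.trace_mul_comm, mul_assoc, pauliOp_mul_self,
        mul_one, Matrix.trace_mul_comm]
    exact_mod_cast this
  exact (sq_eq_sq₀ (norm_nonneg _) (norm_nonneg _)).mp h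

lemma norm_hsVec_pairMap_le (i : Fin M) (X : QMat n) :
    ‖hsVec (pairMap e i X)‖ ≤ 2 * ‖hsVec X‖ / 4 ^ n := by
  rw [pairMap, map_smul, map_sub, norm_smul, Complex.norm_real, Real.norm_eq_abs,
    abs_of_nonneg (by positivity)]
  have := norm_sub_le (hsVec (pauliOp (e (i, true)) * X * pauliOp (e (i, true))))
    (hsVec (pauliOp (e (i, false)) * X * pauliOp (e (i, false))))
  rw [norm_hsVec_pauliOp_conj, norm_hsVec_pauliOp_conj] at this
  rw [one_div, inv_mul_eq_div]
  gcongr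
  linarith

lemma two_mul_eq_four_pow {n M : ℕ} (e : Fin M × Bool ≃ PauliLabel n) : 2 * (M : ℝ) = 4 ^ n := by
  have h := Fintype.card_congr e
  simp only [Fintype.card_prod, Fintype.card_fin, Fintype.card_bool, Fintype.card_pi,
    Finset.prod_const, Finset.card_univ] at h
  rw [mul_comm]
  exact_mod_cast h

/-- By the Khinchine inequality, the random map typically shrinks the Hilbert–Schmidt norm by a
factor of order `d`. -/
lemma sum_norm_pauliMap_pow_four_le (X : QMat n) :
    ∑ β, ‖hsVec (pauliMap (pairWeight e β) X)‖ ^ 4 ≤ 2 ^ M * (12 * ‖hsVec X‖ ^ 4 / 16 ^ n) := by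
  simp only [pauliMap_pairWeight, map_sum, map_smul]
  refine (sum_norm_pow_four_rademacher_le (𝕜 := ℂ) fun i => hsVec (pairMap e i X)).trans ?_
  have h1 : ∑ i, ‖hsVec (pairMap e i X)‖ ^ 2 ≤ 2 * ‖hsVec X‖ ^ 2 / 4 ^ n := by
    calc ∑ i, ‖hsVec (pairMap e i X)‖ ^ 2 ≤ ∑ _i : Fin M, (2 * ‖hsVec X‖ / 4 ^ n) ^ 2 :=
          Finset.sum_le_sum fun i _ =>
            pow_le_pow_left₀ (norm_nonneg _) (norm_hsVec_pairMap_le e i X) 2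
      _ = (2 * (M : ℝ)) * (2 * ‖hsVec X‖ ^ 2 / (4 ^ n) ^ 2) := by
          rw [Finset.sum_const, Finset.card_univ, Fintype.card_fin, nsmul_eq_mul]
          ring
      _ = 2 * ‖hsVec X‖ ^ 2 / 4 ^ n := by
          rw [two_mul_eq_four_pow e]
          field_simp
  have h2 : (∑ i, ‖hsVec (pairMap e i X)‖ ^ 2) ^ 2 ≤ (2 * ‖hsVec X‖ ^ 2 / 4 ^ n) ^ 2 :=
    pow_le_pow_left₀ (Finset.sum_nonneg fun _ _ => by positivity) h1 2
  have h3 : (2 * ‖hsVec X‖ ^ 2 / 4 ^ n) ^ 2 = 4 * ‖hsVec X‖ ^ 4 / 16 ^ n := by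
    have : (16 : ℝ) ^ n = (4 ^ n) ^ 2 := by rw [← pow_mul, mul_comm, pow_mul]; norm_num
    rw [this]
    ring
  rw [h3] at h2
  have : 3 * (∑ i, ‖hsVec (pairMap e i X)‖ ^ 2) ^ 2 ≤ 12 * ‖hsVec X‖ ^ 4 / 16 ^ n := by
    calc _ ≤ 3 * (4 * ‖hsVec X‖ ^ 4 / 16 ^ n) := by gcongr
      _ = _ := by ring
  gcongr

lemma trace_mul_pauliMap (c : PauliLabel n → ℝ) (A X : QMat n) :
    (A * pauliMap c X).trace = (pauliMap c A * X).trace := by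
  simp only [pauliMap_apply, Finset.mul_sum, Finset.sum_mul, Matrix.trace_sum, mul_smul_comm,
    smul_mul_assoc, Matrix.trace_smul]
  refine Finset.sum_congr rfl fun s _ => ?_
  congr 1
  rw [← mul_assoc, ← mul_assoc, Matrix.trace_mul_comm]
  simp only [mul_assoc]

lemma conjTranspose_pauliMap (c : PauliLabel n → ℝ) (A : QMat n) :
    (pauliMap c A).conjTranspose = pauliMap c A.conjTranspose := by
  simp only [pauliMap_apply, Matrix.conjTranspose_sum, Matrix.conjTranspose_smul,
    Matrix.conjTranspose_mul, pauliOp_conjTranspose, RCLike.star_def, Complex.conj_ofReal,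
    mul_assoc]

/-- A single use of the channel: the signs decorrelate the Pauli conjugations, and by the twirl
`∑_P P ρ P = d 1` the squares `tr(A P ρ P)²` sum to at most `d (tr A)²`. -/
lemma sum_trace_mul_pauliMap_sq_le {A ρ : QMat n} (hA : A.PosSemidef) (hρ : ρ.PosSemidef)
    (hρ1 : ρ.trace = 1) :
    ∑ β, ((A * pauliMap (pairWeight e β) ρ).trace.re) ^ 2 ≤ 2 ^ M * (A.trace.re ^ 2 / 8 ^ n) := by
  set a : PauliLabel n → ℝ := fun s => (A * (pauliOp s * ρ * pauliOp s)).trace.re with ha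
  have hconj : ∀ s : PauliLabel n, (pauliOp s * ρ * pauliOp s).PosSemidef := by
    intro s
    have := hρ.mul_mul_conjTranspose_same (pauliOp s)
    rwa [pauliOp_conjTranspose] at this
  have hconj1 : ∀ s : PauliLabel n, (pauliOp s * ρ * pauliOp s).trace = 1 := by
    intro s
    rw [Matrix.trace_mul_cycle, pauliOp_mul_self, one_mul, hρ1]
  have ha0 : ∀ s, 0 ≤ a s := fun s => Matrix.PosSemidef.trace_mul_re_nonneg hA (hconj s)
  have ha1 : ∀ s, a s ≤ A.trace.re := by
    intro s
    have := Matrix.PosSemidef.trace_mul_re_le hA (hconj s)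
    rw [hconj1] at this
    simpa using this
  have hsum : ∑ s, a s = 2 ^ n * A.trace.re := by
    rw [ha, ← Complex.re_sum, ← Matrix.trace_sum, ← Finset.mul_sum, sum_pauliOp_conj, hρ1]
    rw [mul_one, Matrix.mul_smul, mul_one, Matrix.trace_smul, smul_eq_mul]
    have : ((2 : ℂ) ^ n) = (((2 : ℝ) ^ n : ℝ) : ℂ) := by push_cast; rfl
    rw [this, Complex.re_ofReal_mul]
  have hlin : ∀ β, (A * pauliMap (pairWeight e β) ρ).trace.re
      = ∑ i, (boolSign (β i) : ℝ) • ((a (e (i, true)) - a (e (i, false))) / 4 ^ n) := by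
    intro β
    rw [pauliMap_pairWeight, Finset.mul_sum, Matrix.trace_sum, Complex.re_sum]
    refine Finset.sum_congr rfl fun i _ => ?_
    rw [pairMap, smul_smul, ← Complex.ofReal_mul, Matrix.mul_smul, Matrix.trace_smul, smul_eq_mul,
      Complex.re_ofReal_mul, mul_sub, Matrix.trace_sub, Complex.sub_re, smul_eq_mul]
    ring
  have hrad := sum_norm_sq_rademacher (𝕜 := ℝ) (E := ℝ)
    fun i => (a (e (i, true)) - a (e (i, false))) / 4 ^ n
  simp only [RCLike.ofReal_real_eq_id, id, Real.norm_eq_abs, sq_abs] at hrad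
  simp only [hlin]
  rw [hrad]
  gcongr
  calc ∑ i, ((a (e (i, true)) - a (e (i, false))) / 4 ^ n) ^ 2
      ≤ ∑ i, ∑ b, a (e (i, b)) ^ 2 / 16 ^ n := by
        refine Finset.sum_le_sum fun i _ => ?_
        have : (16 : ℝ) ^ n = (4 ^ n) ^ 2 := by rw [← pow_mul, mul_comm, pow_mul]; norm_num
        rw [Fintype.sum_bool, div_pow, ← add_div, this]
        gcongr
        nlinarith [mul_nonneg (ha0 (e (i, true))) (ha0 (e (i, false)))]
    _ = ∑ s, a s ^ 2 / 16 ^ n := by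
        rw [← e.sum_comp, Fintype.sum_prod_type]
    _ ≤ ∑ s, A.trace.re * a s / 16 ^ n := by
        refine Finset.sum_le_sum fun s _ => ?_
        gcongr
        nlinarith [ha0 s, ha1 s]
    _ = A.trace.re ^ 2 / 8 ^ n := by
        rw [← Finset.sum_div, ← Finset.mul_sum, hsum]
        have : (16 : ℝ) ^ n = 2 ^ n * 8 ^ n := by rw [← mul_pow]; norm_num
        rw [this]
        field_simp

/-- Several uses of the channel: the Hilbert–Schmidt norms of the observable and of the state both
lose a factor of order `d`. -/
lemma sum_norm_pauliMap_sq_mul_le {A ρ : QMat n} (hA : A.PosSemidef) (hρ : ρ.PosSemidef)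
    (hρ1 : ρ.trace = 1) :
    ∑ β, ‖hsVec (pauliMap (pairWeight e β) A)‖ ^ 2 * ‖hsVec (pauliMap (pairWeight e β) ρ)‖ ^ 2
      ≤ 2 ^ M * (12 * A.trace.re ^ 2 / 8 ^ n) := by
  have hA' := Matrix.PosSemidef.norm_hsVec_le hA
  have hρ' := Matrix.PosSemidef.norm_hsVec_le hρ
  rw [hρ1, Complex.one_re] at hρ'
  have hA4 := sum_norm_pauliMap_pow_four_le e A
  have hρ4 := sum_norm_pauliMap_pow_four_le e ρ
  have hcs := Finset.sum_mul_sq_le_sq_mul_sq Finset.univ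
    (fun β => ‖hsVec (pauliMap (pairWeight e β) A)‖ ^ 2)
    (fun β => ‖hsVec (pauliMap (pairWeight e β) ρ)‖ ^ 2)
  simp only [← pow_mul] at hcs
  have h1 : 2 ^ M * (12 * ‖hsVec A‖ ^ 4 / 16 ^ n) ≤ 2 ^ M * (12 * A.trace.re ^ 4 / 16 ^ n) := by
    gcongr
  have h2 : 2 ^ M * (12 * ‖hsVec ρ‖ ^ 4 / 16 ^ n) ≤ 2 ^ M * (12 / 16 ^ n) := by
    have : ‖hsVec ρ‖ ^ 4 ≤ 1 := pow_le_one₀ (norm_nonneg _) hρ'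
    gcongr
    linarith
  have h3 := hcs.trans (mul_le_mul (hA4.trans h1) (hρ4.trans h2)
    (Finset.sum_nonneg fun _ _ => by positivity) (by positivity))
  have h4 : 2 ^ M * (12 * A.trace.re ^ 4 / 16 ^ n) * (2 ^ M * (12 / 16 ^ n))
      = (2 ^ M * (12 * A.trace.re ^ 2 / 16 ^ n)) ^ 2 := by ring
  rw [h4] at h3
  refine (abs_le_of_sq_le_sq' h3 (by positivity)).2.trans ?_
  gcongr
  norm_num

/-- The output of several uses of a channel of the family. The depolarizing part of the last use
fixes the maximally mixed part `1 / d` of the output. If there is an earlier use, the state entering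
the last one has a traceless part that the first use has already contracted. -/
lemma foldl_perturbDist {η : ℝ} (h0 : 0 ≤ η) (h1 : η ≤ 1) (β : Fin M → Bool)
    {ρ : QMat n} (hρ1 : ρ.trace = 1) (L : List (QMat n →ₗ[ℂ] QMat n))
    (hL : ∀ Φ ∈ L, IsUnitalChannel Φ) :
    ∃ X : QMat n, (X = ρ ∨ ‖hsVec X‖ ≤ ‖hsVec (pauliMap (pairWeight e β) ρ)‖) ∧
      L.foldl (fun σ Φ => pauliChannel (perturbDist e h0 h1 β) (Φ σ))
          (pauliChannel (perturbDist e h0 h1 β) ρ)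
        = (1 / 2 ^ n : ℂ) • (1 : QMat n) + (η : ℂ) • pauliMap (pairWeight e β) X := by
  set P := pauliChannel (perturbDist e h0 h1 β) with hP
  have hPu : IsUnitalChannel P := pauliChannel_isUnitalChannel _
  set τ : QMat n := (1 / 2 ^ n : ℂ) • (1 : QMat n) with hτ
  have hPρ : P ρ = τ + (η : ℂ) • pauliMap (pairWeight e β) ρ := by
    rw [hP, pauliChannel_perturbDist, hρ1]
  have key : ∀ L : List (QMat n →ₗ[ℂ] QMat n), (∀ Φ ∈ L, IsUnitalChannel Φ) →
      (L.foldl (fun σ Φ => P (Φ σ)) (P ρ)).trace = 1 ∧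
      ‖hsVec (L.foldl (fun σ Φ => P (Φ σ)) (P ρ) - τ)‖
        ≤ ‖hsVec (pauliMap (pairWeight e β) ρ)‖ := by
    intro L
    induction L using List.reverseRecOn with
    | nil =>
      intro _
      refine ⟨by rw [List.foldl_nil, hPu.1.trace_apply, hρ1], ?_⟩
      rw [List.foldl_nil, hPρ, add_sub_cancel_left, map_smul, norm_smul, Complex.norm_real,
        Real.norm_eq_abs, abs_of_nonneg h0]
      exact mul_le_of_le_one_left (norm_nonneg _) h1
    | append_singleton L Φ ih =>
      intro hL
      obtain ⟨ih1, ih2⟩ := ih fun Ψ hΨ => hL Ψ (by simp [hΨ])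
      have hΦ := hL Φ (by simp)
      rw [List.foldl_append, List.foldl_cons, List.foldl_nil]
      refine ⟨by rw [hPu.1.trace_apply, hΦ.1.trace_apply, ih1], ?_⟩
      have hfix : P (Φ τ) = τ := by rw [hτ, map_smul, hΦ.2, map_smul, hPu.2]
      nth_rewrite 1 [← hfix]
      rw [← map_sub, ← map_sub]
      exact (hPu.norm_hsVec_le _).trans ((hΦ.norm_hsVec_le _).trans ih2)
  rcases L.eq_nil_or_concat with rfl | ⟨L, Φ, rfl⟩
  · exact ⟨ρ, Or.inl rfl, hPρ⟩
  · rw [List.concat_eq_append] at hL ⊢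
    obtain ⟨k1, k2⟩ := key L fun Ψ hΨ => hL Ψ (by simp [hΨ])
    have hΦ := hL Φ (by simp)
    rw [List.foldl_append, List.foldl_cons, List.foldl_nil]
    set σ := L.foldl (fun σ Φ => P (Φ σ)) (P ρ)
    refine ⟨Φ (σ - τ), Or.inr ((hΦ.norm_hsVec_le _).trans k2), ?_⟩
    rw [hP, pauliChannel_perturbDist, hΦ.1.trace_apply, k1, map_sub, map_sub, hτ, map_smul Φ, hΦ.2,
      map_smul (pauliMap _), pauliMap_pairWeight_one, smul_zero, sub_zero]

/-! ### Finite product distributions -/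

section Product

variable {N : ℕ} {k : Fin N → ℕ}

lemma sum_prod_eq_one {w : (t : Fin N) → Fin (k t) → ℝ} (hw : ∀ t, ∑ i, w t i = 1) :
    ∑ o : (t : Fin N) → Fin (k t), ∏ t, w t (o t) = 1 := by
  rw [← Fintype.prod_sum]
  simp [hw]

lemma sum_prod_mul_apply {w : (t : Fin N) → Fin (k t) → ℝ} (hw : ∀ t, ∑ i, w t i = 1)
    (f : (t : Fin N) → Fin (k t) → ℝ) (t₀ : Fin N) :
    ∑ o : (t : Fin N) → Fin (k t), (∏ t, w t (o t)) * f t₀ (o t₀) = ∑ i, w t₀ i * f t₀ i := by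
  have h : ∀ o : (t : Fin N) → Fin (k t), (∏ t, w t (o t)) * f t₀ (o t₀)
      = ∏ t, w t (o t) * (if t = t₀ then f t (o t) else 1) := by
    intro o
    rw [Finset.prod_mul_distrib, Finset.prod_ite_eq' Finset.univ t₀ fun t => f t (o t)]
    simp
  simp only [h]
  rw [← Fintype.prod_sum fun t i => w t i * (if t = t₀ then f t i else 1),
    Finset.prod_eq_single t₀]
  · simp
  · intro t _ ht
    simp [ht, hw]
  · simp

lemma sum_prod_mul_apply_mul_apply {w : (t : Fin N) → Fin (k t) → ℝ} (hw : ∀ t, ∑ i, w t i = 1)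
    (f : (t : Fin N) → Fin (k t) → ℝ) {t₀ t₁ : Fin N} (h01 : t₀ ≠ t₁) :
    ∑ o : (t : Fin N) → Fin (k t), (∏ t, w t (o t)) * (f t₀ (o t₀) * f t₁ (o t₁))
      = (∑ i, w t₀ i * f t₀ i) * ∑ i, w t₁ i * f t₁ i := by
  have h : ∀ o : (t : Fin N) → Fin (k t), (∏ t, w t (o t)) * (f t₀ (o t₀) * f t₁ (o t₁))
      = ∏ t, w t (o t) * ((if t = t₀ then f t (o t) else 1) * (if t = t₁ then f t (o t) else 1)) := by
    intro o
    rw [Finset.prod_mul_distrib, Finset.prod_mul_distrib,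
      Finset.prod_ite_eq' Finset.univ t₀ fun t => f t (o t),
      Finset.prod_ite_eq' Finset.univ t₁ fun t => f t (o t)]
    simp
  simp only [h]
  rw [← Fintype.prod_sum fun t i =>
    w t i * ((if t = t₀ then f t i else 1) * (if t = t₁ then f t i else 1)),
    Fintype.prod_eq_mul t₀ t₁ h01]
  · simp [h01, h01.symm]
  · intro t ht
    simp [ht.1, ht.2, hw]

/-- The change-of-measure step of the Fano argument: if a test `A` has probability `π` under the
product distribution `p` and `δ` under `q`, then
`π log a + (1 - π) log b ≤ ∑ₜ χ²(pₜ ‖ qₜ) + a δ + b (1 - δ) - 1`.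
It follows from `log x ≤ x - 1`, applied to `a q / p`, to `b q / p` and to the factors `pₜ / qₜ`. -/
lemma log_test_le_chiSq {p q : (t : Fin N) → Fin (k t) → ℝ}
    (hp0 : ∀ t i, 0 ≤ p t i) (hp1 : ∀ t, ∑ i, p t i = 1)
    (hq0 : ∀ t i, 0 ≤ q t i) (hq1 : ∀ t, ∑ i, q t i = 1) (hpq : ∀ t i, q t i = 0 → p t i = 0)
    (A : ((t : Fin N) → Fin (k t)) → ℝ) (hA0 : ∀ o, 0 ≤ A o) (hA1 : ∀ o, A o ≤ 1)
    {a b : ℝ} (ha : 0 < a) (hb : 0 < b) :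
    (∑ o, (∏ t, p t (o t)) * A o) * Real.log a
        + (1 - ∑ o, (∏ t, p t (o t)) * A o) * Real.log b
      ≤ (∑ t, ∑ i, (p t i - q t i) ^ 2 / q t i) + a * (∑ o, (∏ t, q t (o t)) * A o)
        + b * (1 - ∑ o, (∏ t, q t (o t)) * A o) - 1 := by
  have point : ∀ o : (t : Fin N) → Fin (k t),
      (∏ t, p t (o t)) * (A o * Real.log a + (1 - A o) * Real.log b)
        ≤ (∏ t, p t (o t)) * (∑ t, (p t (o t) / q t (o t) - 1))
          + (∏ t, q t (o t)) * (a * A o + b * (1 - A o)) - ∏ t, p t (o t) := by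
    intro o
    have hP0 : 0 ≤ ∏ t, p t (o t) := Finset.prod_nonneg fun t _ => hp0 t _
    have hQ0 : 0 ≤ ∏ t, q t (o t) := Finset.prod_nonneg fun t _ => hq0 t _
    have hA0' := hA0 o
    have hA1' : 0 ≤ 1 - A o := by linarith [hA1 o]
    rcases hP0.eq_or_lt with hP | hP
    · rw [← hP]
      have : 0 ≤ (∏ t, q t (o t)) * (a * A o + b * (1 - A o)) := by positivity
      linarith
    · have hpt : ∀ t, 0 < p t (o t) := fun t => (hp0 t _).lt_of_ne fun h =>
        hP.ne' (Finset.prod_eq_zero (Finset.mem_univ t) h.symm)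
      have hqt : ∀ t, 0 < q t (o t) := fun t => (hq0 t _).lt_of_ne fun h =>
        (hpt t).ne' (hpq t _ h.symm)
      have hQ : 0 < ∏ t, q t (o t) := Finset.prod_pos fun t _ => hqt t
      set P := ∏ t, p t (o t) with hPdef
      set Q := ∏ t, q t (o t) with hQdef
      have h1 : Real.log (P / Q) ≤ ∑ t, (p t (o t) / q t (o t) - 1) := by
        rw [hPdef, hQdef, ← Finset.prod_div_distrib,
          Real.log_prod fun t _ => (div_pos (hpt t) (hqt t)).ne']
        exact Finset.sum_le_sum fun t _ => Real.log_le_sub_one_of_pos (div_pos (hpt t) (hqt t))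
      have h2 : ∀ x : ℝ, 0 < x → Real.log x ≤ Real.log (P / Q) + (x * Q / P - 1) := by
        intro x hx
        have h := Real.log_le_sub_one_of_pos (show 0 < x * Q / P by positivity)
        have h' : Real.log x = Real.log (P / Q) + Real.log (x * Q / P) := by
          rw [← Real.log_mul (by positivity) (by positivity)]
          congr 1
          field_simp
        linarith
      have h3 : A o * Real.log a + (1 - A o) * Real.log b
          ≤ (∑ t, (p t (o t) / q t (o t) - 1)) + (Q / P * (a * A o + b * (1 - A o)) - 1) := by
        have ha' := mul_le_mul_of_nonneg_left ((h2 a ha).trans (add_le_add_left h1 _)) hA0'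
        have hb' := mul_le_mul_of_nonneg_left ((h2 b hb).trans (add_le_add_left h1 _)) hA1'
        refine (add_le_add ha' hb').trans (le_of_eq ?_)
        ring
      refine (mul_le_mul_of_nonneg_left h3 hP.le).trans (le_of_eq ?_)
      field_simp
      ring
  have hsum := Finset.sum_le_sum fun o (_ : o ∈ Finset.univ) => point o
  have hP1 := sum_prod_eq_one hp1
  have hQ1 := sum_prod_eq_one hq1
  have e1 : ∑ o : (t : Fin N) → Fin (k t),
      (∏ t, p t (o t)) * (A o * Real.log a + (1 - A o) * Real.log b)
      = (∑ o, (∏ t, p t (o t)) * A o) * Real.log a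
        + (1 - ∑ o, (∏ t, p t (o t)) * A o) * Real.log b := by
    have h : ∀ o : (t : Fin N) → Fin (k t),
        (∏ t, p t (o t)) * (A o * Real.log a + (1 - A o) * Real.log b)
        = (∏ t, p t (o t)) * A o * Real.log a + (∏ t, p t (o t)) * Real.log b
          - (∏ t, p t (o t)) * A o * Real.log b := fun o => by ring
    simp only [h, Finset.sum_sub_distrib, Finset.sum_add_distrib, ← Finset.sum_mul, hP1]
    ring
  have e2 : ∑ o : (t : Fin N) → Fin (k t), (∏ t, q t (o t)) * (a * A o + b * (1 - A o))
      = a * (∑ o, (∏ t, q t (o t)) * A o) + b * (1 - ∑ o, (∏ t, q t (o t)) * A o) := by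
    have h : ∀ o : (t : Fin N) → Fin (k t), (∏ t, q t (o t)) * (a * A o + b * (1 - A o))
        = a * ((∏ t, q t (o t)) * A o) + b * ∏ t, q t (o t)
          - b * ((∏ t, q t (o t)) * A o) := fun o => by ring
    simp only [h, Finset.sum_sub_distrib, Finset.sum_add_distrib, ← Finset.mul_sum, hQ1]
    ring
  have e3 : ∑ o : (t : Fin N) → Fin (k t),
      (∏ t, p t (o t)) * (∑ t, (p t (o t) / q t (o t) - 1))
      = ∑ t, ∑ i, (p t i - q t i) ^ 2 / q t i := by
    simp only [Finset.mul_sum]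
    rw [Finset.sum_comm]
    refine Finset.sum_congr rfl fun t _ => ?_
    rw [sum_prod_mul_apply hp1 (fun t i => p t i / q t i - 1) t]
    have h : ∀ i, (p t i - q t i) ^ 2 / q t i = p t i * (p t i / q t i - 1) - (p t i - q t i) := by
      intro i
      by_cases h : q t i = 0
      · simp [h, hpq t i h]
      · field_simp
    simp only [h, Finset.sum_sub_distrib (f := fun i => p t i * _), Finset.sum_sub_distrib, hp1, hq1]
    simp
  rw [Finset.sum_sub_distrib, Finset.sum_add_distrib, e1, e2, e3, hP1] at hsum
  linarith

end Product

/-! ### Hamming balls -/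

lemma card_hammingBall_mul_le {M : ℕ} (β₀ : Fin M → Bool) (r : ℕ) :
    ((Finset.univ.filter fun β : Fin M → Bool => hammingDist β β₀ ≤ r).card : ℝ) * (1 / 3) ^ r
      ≤ (4 / 3) ^ M := by
  have h1 : ∑ β : Fin M → Bool, ((1 : ℝ) / 3) ^ hammingDist β β₀ = (4 / 3) ^ M := by
    have h : ∀ β : Fin M → Bool, ((1 : ℝ) / 3) ^ hammingDist β β₀
        = ∏ i, if β i ≠ β₀ i then (1 : ℝ) / 3 else 1 := by
      intro β
      rw [Finset.prod_ite, Finset.prod_const, Finset.prod_const_one, mul_one]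
      rfl
    simp only [h]
    rw [← Fintype.prod_sum fun i b => if b ≠ β₀ i then (1 : ℝ) / 3 else 1]
    have h' : ∀ i, ∑ b, (if b ≠ β₀ i then (1 : ℝ) / 3 else 1) = 4 / 3 := by
      intro i
      cases β₀ i <;> norm_num
    simp only [h', Finset.prod_const, Finset.card_univ, Fintype.card_fin]
  rw [← h1, ← nsmul_eq_mul]
  refine (Finset.card_nsmul_le_sum _ _ _ fun β hβ => ?_).trans
    (Finset.sum_le_sum_of_subset_of_nonneg (Finset.filter_subset _ _) fun _ _ _ => by positivity)
  exact pow_le_pow_of_le_one (by norm_num) (by norm_num) (Finset.mem_filter.mp hβ).2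

lemma sum_abs_perturbDist_sub {η : ℝ} (h0 : 0 ≤ η) (h1 : η ≤ 1) (β β' : Fin M → Bool) :
    ∑ s, |(perturbDist e h0 h1 β).1 s - (perturbDist e h0 h1 β').1 s|
      = 4 * η * hammingDist β β' / 4 ^ n := by
  rw [← e.sum_comp, Fintype.sum_prod_type]
  have h : ∀ i b, |(perturbDist e h0 h1 β).1 (e (i, b)) - (perturbDist e h0 h1 β').1 (e (i, b))|
      = if β i ≠ β' i then 2 * η / 4 ^ n else 0 := by
    intro i b
    simp only [perturbDist, pairWeight, Equiv.symm_apply_apply]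
    have : (1 : ℝ) / 4 ^ n + η * (boolSign (β i) * boolSign b / 4 ^ n)
        - (1 / 4 ^ n + η * (boolSign (β' i) * boolSign b / 4 ^ n))
        = (boolSign (β i) - boolSign (β' i)) * boolSign b * (η / 4 ^ n) := by ring
    rw [this, abs_mul, abs_mul, abs_boolSign, abs_of_nonneg (show 0 ≤ η / 4 ^ n by positivity)]
    cases β i <;> cases β' i <;> norm_num [boolSign] <;> ring
  simp only [h, Finset.sum_const, Finset.card_univ, Fintype.card_bool, hammingDist]
  rw [← Finset.smul_sum, ← Finset.sum_filter, Finset.sum_const, nsmul_eq_mul, nsmul_eq_mul]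
  push_cast
  ring

/-- No Pauli channel is close to more than a small fraction of the family. -/
lemma card_perturbDist_close_le {ε : ℝ} (h0 : 0 ≤ 4 * ε) (h1 : 4 * ε ≤ 1) (hε : 0 < ε)
    {r : ℕ} (hr : (4 : ℝ) ^ n / 8 < r + 1) {B : ℝ} (hB0 : 0 ≤ B)
    (hB : ∀ β₀ : Fin M → Bool,
      ((Finset.univ.filter fun β : Fin M → Bool => hammingDist β β₀ ≤ r).card : ℝ) ≤ B)
    (q : PauliDist n) [DecidablePred fun β : Fin M → Bool =>
      diamondDist (pauliChannel (perturbDist e h0 h1 β)) (pauliChannel q) ≤ ε] :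
    ((Finset.univ.filter fun β : Fin M → Bool =>
      diamondDist (pauliChannel (perturbDist e h0 h1 β)) (pauliChannel q) ≤ ε).card : ℝ) ≤ B := by
  rcases Finset.eq_empty_or_nonempty (Finset.univ.filter fun β : Fin M → Bool =>
      diamondDist (pauliChannel (perturbDist e h0 h1 β)) (pauliChannel q) ≤ ε) with h | ⟨β₀, hβ₀⟩
  · rw [h]; simpa using hB0
  · refine le_trans ?_ (hB β₀)
    refine Nat.cast_le.mpr (Finset.card_le_card fun β hβ => ?_)
    rw [Finset.mem_filter] at hβ hβ₀ ⊢
    refine ⟨Finset.mem_univ _, ?_⟩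
    have d1 := hβ.2
    have d2 := hβ₀.2
    rw [diamondDist_pauliChannel] at d1 d2
    have d3 : ∑ s, |(perturbDist e h0 h1 β).1 s - (perturbDist e h0 h1 β₀).1 s| ≤ 2 * ε := by
      calc _ ≤ ∑ s, (|(perturbDist e h0 h1 β).1 s - q.1 s|
            + |(perturbDist e h0 h1 β₀).1 s - q.1 s|) := by
            refine Finset.sum_le_sum fun s _ => ?_
            rw [abs_sub_comm ((perturbDist e h0 h1 β₀).1 s)]
            exact abs_sub_le _ _ _
        _ ≤ 2 * ε := by rw [Finset.sum_add_distrib]; linarith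
    rw [sum_abs_perturbDist_sub, div_le_iff₀ (by positivity)] at d3
    have d4 : (hammingDist β β₀ : ℝ) ≤ 4 ^ n / 8 := by
      have : ε * (16 * (hammingDist β β₀ : ℝ)) ≤ ε * (2 * 4 ^ n) := by linarith
      have := le_of_mul_le_mul_left this hε
      linarith
    have : (hammingDist β β₀ : ℝ) < r + 1 := d4.trans_lt hr
    exact Nat.lt_succ_iff.mp (by exact_mod_cast this)

/-- A random guess lies in a random set with small probability if every point lies in few of the
sets. -/
lemma sum_toOuterMeasure_toReal_le {α ι : Type*} [Fintype ι] (μ : PMF α) (S : ι → Set α) {B : ℝ}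
    (hB0 : 0 ≤ B) [∀ x, DecidablePred fun i => x ∈ S i]
    (hB : ∀ x, ((Finset.univ.filter fun i => x ∈ S i).card : ℝ) ≤ B) :
    ∑ i, (μ.toOuterMeasure (S i)).toReal ≤ B := by
  have hfin : ∀ i, μ.toOuterMeasure (S i) ≠ ⊤ := fun i => by
    rw [PMF.toOuterMeasure_apply]
    exact ne_top_of_le_ne_top (by rw [μ.tsum_coe]; exact ENNReal.one_ne_top)
      (ENNReal.tsum_le_tsum fun x => Set.indicator_le_self _ _ x)
  rw [← ENNReal.toReal_sum fun i _ => hfin i]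
  refine ENNReal.toReal_le_of_le_ofReal hB0 ?_
  simp only [PMF.toOuterMeasure_apply]
  rw [← Summable.tsum_finsetSum fun i _ => ENNReal.summable]
  calc ∑' x, ∑ i, (S i).indicator μ x ≤ ∑' x, μ x * ENNReal.ofReal B := by
        refine ENNReal.tsum_le_tsum fun x => ?_
        have : ∑ i, (S i).indicator μ x = ((Finset.univ.filter fun i => x ∈ S i).card : ENNReal) * μ x := by
          simp only [Set.indicator_apply, ← Finset.sum_filter, Finset.sum_const, nsmul_eq_mul]
        rw [this, mul_comm]
        gcongr
        rw [← ENNReal.ofReal_natCast]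
        exact ENNReal.ofReal_le_ofReal (hB x)
    _ = ENNReal.ofReal B := by rw [ENNReal.tsum_mul_right, PMF.tsum_coe, one_mul]

/-! ### The lower bound on the number of measurements -/

namespace NonadaptiveStrategy

variable (S : NonadaptiveStrategy n)

lemma output_posSemidef_and_trace {P : QMat n →ₗ[ℂ] QMat n} (hP : IsQuantumChannel P)
    (t : Fin S.steps) : (S.output P t).PosSemidef ∧ (S.output P t).trace = 1 := by
  have key : ∀ (L : List (QMat n →ₗ[ℂ] QMat n)) (σ : QMat n), (∀ Φ ∈ L, IsUnitalChannel Φ) →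
      σ.PosSemidef → σ.trace = 1 →
      (L.foldl (fun σ Φ => P (Φ σ)) σ).PosSemidef ∧
        (L.foldl (fun σ Φ => P (Φ σ)) σ).trace = 1 := by
    intro L
    induction L with
    | nil => exact fun σ _ h1 h2 => ⟨h1, h2⟩
    | cons Φ L ih =>
      intro σ hL h1 h2
      have hΦ := hL Φ (by simp)
      refine ih _ (fun Ψ hΨ => hL Ψ (by simp [hΨ])) (hP.posSemidef (hΦ.1.posSemidef h1)) ?_
      rw [hP.trace_apply, hΦ.1.trace_apply, h2]
  refine key _ _ (S.interleaved_unital t) (hP.posSemidef (S.input_posSemidef t)) ?_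
  rw [hP.trace_apply, S.input_trace]

/-- The probability of the outcome `i` of step `t`. -/
def stepProb (P : QMat n →ₗ[ℂ] QMat n) (t : Fin S.steps) (i : Fin (S.outcomes t)) : ℝ :=
  (S.output P t * S.povm t i).trace.re

/-- The probability of the outcome `i` of step `t` when the measured state is maximally mixed. -/
def mixedProb (t : Fin S.steps) (i : Fin (S.outcomes t)) : ℝ :=
  (S.povm t i).trace.re / 2 ^ n

lemma stepProb_nonneg {P : QMat n →ₗ[ℂ] QMat n} (hP : IsQuantumChannel P) (t : Fin S.steps)
    (i : Fin (S.outcomes t)) : 0 ≤ S.stepProb P t i :=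
  Matrix.PosSemidef.trace_mul_re_nonneg (S.output_posSemidef_and_trace hP t).1 (S.povm_posSemidef t i)

lemma sum_stepProb {P : QMat n →ₗ[ℂ] QMat n} (hP : IsQuantumChannel P) (t : Fin S.steps) :
    ∑ i, S.stepProb P t i = 1 := by
  simp only [stepProb]
  rw [← Complex.re_sum, ← Matrix.trace_sum, ← Finset.mul_sum, S.povm_sum, mul_one,
    (S.output_posSemidef_and_trace hP t).2, Complex.one_re]

lemma povm_trace_nonneg (t : Fin S.steps) (i : Fin (S.outcomes t)) :
    0 ≤ (S.povm t i).trace.re :=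
  (Complex.nonneg_iff.mp (S.povm_posSemidef t i).trace_nonneg).1

lemma sum_povm_trace (t : Fin S.steps) : ∑ i, (S.povm t i).trace.re = 2 ^ n := by
  rw [← Complex.re_sum, ← Matrix.trace_sum, S.povm_sum, Matrix.trace_one]
  simp only [Fintype.card_pi, Fintype.card_fin, Finset.prod_const, Finset.card_univ]
  norm_cast

lemma mixedProb_nonneg (t : Fin S.steps) (i : Fin (S.outcomes t)) : 0 ≤ S.mixedProb t i :=
  div_nonneg (S.povm_trace_nonneg t i) (by positivity)

lemma sum_mixedProb (t : Fin S.steps) : ∑ i, S.mixedProb t i = 1 := by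
  simp only [mixedProb]
  rw [← Finset.sum_div, S.sum_povm_trace, div_self (by positivity)]

lemma stepProb_eq_zero_of_mixedProb_eq_zero {P : QMat n →ₗ[ℂ] QMat n} (hP : IsQuantumChannel P)
    (t : Fin S.steps) (i : Fin (S.outcomes t)) (h : S.mixedProb t i = 0) :
    S.stepProb P t i = 0 := by
  have h0 : (S.povm t i).trace.re = 0 := by
    rw [mixedProb, div_eq_zero_iff] at h
    exact h.resolve_right (by positivity)
  refine le_antisymm ?_ (S.stepProb_nonneg hP t i)
  have := Matrix.PosSemidef.trace_mul_re_le (S.output_posSemidef_and_trace hP t).1 (S.povm_posSemidef t i)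
  rwa [h0, mul_zero] at this

lemma sum_stepProb_sub_mixedProb_sq_le {η : ℝ} (h0 : 0 ≤ η) (h1 : η ≤ 1) (t : Fin S.steps)
    (i : Fin (S.outcomes t)) :
    ∑ β, (S.stepProb (pauliChannel (perturbDist e h0 h1 β)) t i - S.mixedProb t i) ^ 2
      ≤ 2 ^ M * (13 * η ^ 2 * (S.povm t i).trace.re ^ 2 / 8 ^ n) := by
  set A := S.povm t i with hA
  set ρ := S.input t with hρ
  have hAp : A.PosSemidef := S.povm_posSemidef t i
  have hρp : ρ.PosSemidef := S.input_posSemidef t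
  have hρ1 : ρ.trace = 1 := S.input_trace t
  have hβ : ∀ β, (S.stepProb (pauliChannel (perturbDist e h0 h1 β)) t i - S.mixedProb t i) ^ 2
      ≤ η ^ 2 * (((A * pauliMap (pairWeight e β) ρ).trace.re) ^ 2
        + ‖hsVec (pauliMap (pairWeight e β) A)‖ ^ 2
          * ‖hsVec (pauliMap (pairWeight e β) ρ)‖ ^ 2) := by
    intro β
    obtain ⟨X, hX, hout⟩ := foldl_perturbDist e h0 h1 β hρ1 (S.interleaved t)
      (S.interleaved_unital t)
    have hdiff : S.stepProb (pauliChannel (perturbDist e h0 h1 β)) t i - S.mixedProb t i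
        = η * (A * pauliMap (pairWeight e β) X).trace.re := by
      rw [stepProb, mixedProb, output, ← hρ, hout, add_mul, Matrix.trace_add, Complex.add_re,
        smul_mul_assoc, one_mul, Matrix.trace_smul, smul_mul_assoc, Matrix.trace_smul,
        smul_eq_mul, smul_eq_mul, Complex.re_ofReal_mul, ← hA, Matrix.trace_mul_comm]
      have : (1 / 2 ^ n : ℂ) = ((1 / 2 ^ n : ℝ) : ℂ) := by push_cast; rfl
      rw [this, Complex.re_ofReal_mul]
      ring
    rw [hdiff, mul_pow]
    refine mul_le_mul_of_nonneg_left ?_ (sq_nonneg η)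
    rcases hX with rfl | hX
    · exact le_add_of_nonneg_right (by positivity)
    · refine le_trans ?_ (le_add_of_nonneg_left (sq_nonneg _))
      have hself : (pauliMap (pairWeight e β) A).conjTranspose = pauliMap (pairWeight e β) A := by
        rw [conjTranspose_pauliMap, hAp.1.eq]
      have hcs := norm_trace_mul_le (pauliMap (pairWeight e β) A) X
      rw [hself, ← trace_mul_pauliMap] at hcs
      have h2 : |(A * pauliMap (pairWeight e β) X).trace.re|
          ≤ ‖hsVec (pauliMap (pairWeight e β) A)‖ * ‖hsVec (pauliMap (pairWeight e β) ρ)‖ :=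
        (Complex.abs_re_le_norm _).trans
          (hcs.trans (mul_le_mul_of_nonneg_left hX (norm_nonneg _)))
      rw [← mul_pow, ← sq_abs]
      exact pow_le_pow_left₀ (abs_nonneg _) h2 2
  refine (Finset.sum_le_sum fun β _ => hβ β).trans ?_
  rw [← Finset.mul_sum, Finset.sum_add_distrib]
  have k1 := sum_trace_mul_pauliMap_sq_le e hAp hρp hρ1
  have k2 := sum_norm_pauliMap_sq_mul_le e hAp hρp hρ1
  refine (mul_le_mul_of_nonneg_left (add_le_add k1 k2) (sq_nonneg η)).trans (le_of_eq ?_)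
  ring

/-- Averaged over the family, a step carries `O(η² / d)` of `χ²`-information. -/
lemma sum_chiSq_le {η : ℝ} (h0 : 0 ≤ η) (h1 : η ≤ 1) (t : Fin S.steps) :
    ∑ β, ∑ i, (S.stepProb (pauliChannel (perturbDist e h0 h1 β)) t i - S.mixedProb t i) ^ 2
        / S.mixedProb t i ≤ 2 ^ M * (13 * η ^ 2 / 2 ^ n) := by
  rw [Finset.sum_comm]
  calc _ ≤ ∑ i, 2 ^ M * (13 * η ^ 2 / 4 ^ n) * (S.povm t i).trace.re := by
        refine Finset.sum_le_sum fun i _ => ?_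
        rw [← Finset.sum_div]
        rcases (S.povm_trace_nonneg t i).eq_or_lt with h | h
        · simp [mixedProb, ← h]
        · rw [div_le_iff₀ (by rw [mixedProb]; positivity)]
          refine (S.sum_stepProb_sub_mixedProb_sq_le e h0 h1 t i).trans (le_of_eq ?_)
          have : (8 : ℝ) ^ n = 4 ^ n * 2 ^ n := by rw [← mul_pow]; norm_num
          rw [mixedProb, this]
          field_simp
    _ = 2 ^ M * (13 * η ^ 2 / 2 ^ n) := by
        rw [← Finset.mul_sum, S.sum_povm_trace, ← two_pow_mul_self]
        field_simp

/-- A strategy that learns the family has gathered a large `χ²`-information: `B` bounds the number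
of members of the family that are close to a common channel, relative to the size of the family. -/
lemma log_le_of_learnsPauli {M : ℕ} (e : Fin M × Bool ≃ PauliLabel n) {ε : ℝ}
    (hL : S.LearnsPauli ε) (hε : 0 < ε) (h0 : 0 ≤ 4 * ε)
    (h1 : 4 * ε ≤ 1) {r : ℕ} (hr : (4 : ℝ) ^ n / 8 < r + 1) {B : ℝ} (hB0 : 0 < B) (hB1 : B ≤ 1)
    (hB : ∀ β₀ : Fin M → Bool, ((Finset.univ.filter fun β : Fin M → Bool =>
      hammingDist β β₀ ≤ r).card : ℝ) ≤ 2 ^ M * B) :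
    2 * Real.log (2 / (3 * B)) - Real.log 3 ≤ 3 * (S.steps * (208 * ε ^ 2 / 2 ^ n)) := by
  classical
  set P : (Fin M → Bool) → QMat n →ₗ[ℂ] QMat n := fun β =>
    pauliChannel (perturbDist e h0 h1 β) with hPdef
  have hP : ∀ β, IsQuantumChannel (P β) := fun β => (pauliChannel_isUnitalChannel _).1
  set G : (Fin M → Bool) → Set (PauliDist n) := fun β =>
    {q | diamondDist (P β) (pauliChannel q) ≤ ε} with hG
  set A : (Fin M → Bool) → ((t : Fin S.steps) → Fin (S.outcomes t)) → ℝ := fun β o =>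
    ((S.estimate o).toOuterMeasure (G β)).toReal with hA
  have hA0 : ∀ β o, 0 ≤ A β o := fun β o => ENNReal.toReal_nonneg
  have hA1 : ∀ β o, A β o ≤ 1 := fun β o => by
    have := sum_toOuterMeasure_toReal_le (ι := Unit) (S.estimate o) (fun _ => G β) (B := 1)
      zero_le_one (fun x => by
        have := Finset.card_filter_le (Finset.univ : Finset Unit) (fun _ => x ∈ G β)
        exact_mod_cast this)
    simpa using this
  set w : ((t : Fin S.steps) → Fin (S.outcomes t)) → ℝ := fun o => ∏ t, S.mixedProb t (o t) with hw
  set π : (Fin M → Bool) → ℝ := fun β => ∑ o, (∏ t, S.stepProb (P β) t (o t)) * A β o with hπ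
  set δ : (Fin M → Bool) → ℝ := fun β => ∑ o, w o * A β o with hδ
  have hsucc : ∀ β, 2 / 3 ≤ π β := fun β => hL (perturbDist e h0 h1 β)
  have hδ0 : ∀ β, 0 ≤ δ β := fun β => Finset.sum_nonneg fun o _ =>
    mul_nonneg (Finset.prod_nonneg fun t _ => S.mixedProb_nonneg t _) (hA0 β o)
  have hδsum : ∑ β, δ β ≤ 2 ^ M * B := by
    rw [hδ, Finset.sum_comm]
    calc _ ≤ ∑ o, w o * (2 ^ M * B) := by
          refine Finset.sum_le_sum fun o _ => ?_
          rw [← Finset.mul_sum]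
          refine mul_le_mul_of_nonneg_left ?_
            (Finset.prod_nonneg fun t _ => S.mixedProb_nonneg t _)
          refine sum_toOuterMeasure_toReal_le (S.estimate o) G (by positivity) fun q => ?_
          exact card_perturbDist_close_le e h0 h1 hε hr (by positivity) hB q
      _ = 2 ^ M * B := by
          rw [← Finset.sum_mul, sum_prod_eq_one S.sum_mixedProb, one_mul]
  -- The ratio `a` on the test and `1 / 3` on its complement give the best bound for a test of
  -- probability `2 / 3` and at most `B`.
  set a := 2 / (3 * B) with ha
  have ha0 : 0 < a := by positivity
  have hab : Real.log (1 / 3) ≤ Real.log a := by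
    refine Real.log_le_log (by norm_num) ?_
    rw [ha, div_le_div_iff₀ (by norm_num) (by positivity)]
    linarith
  have hmain : ∀ β, 2 / 3 * Real.log a + 1 / 3 * Real.log (1 / 3)
      ≤ (∑ t, ∑ i, (S.stepProb (P β) t i - S.mixedProb t i) ^ 2 / S.mixedProb t i)
        + a * δ β - 2 / 3 := by
    intro β
    have h := log_test_le_chiSq (p := S.stepProb (P β)) (q := S.mixedProb)
      (S.stepProb_nonneg (hP β)) (S.sum_stepProb (hP β)) S.mixedProb_nonneg S.sum_mixedProb
      (S.stepProb_eq_zero_of_mixedProb_eq_zero (hP β)) (A β) (hA0 β) (hA1 β) ha0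
      (show (0 : ℝ) < 1 / 3 by norm_num)
    have h2 := mul_le_mul_of_nonneg_right (hsucc β) (sub_nonneg.mpr hab)
    have h3 := hδ0 β
    simp only [hπ, hδ, hw] at h2 h3 ⊢
    linarith
  have hsum := Finset.sum_le_sum fun β (_ : β ∈ Finset.univ) => hmain β
  rw [Finset.sum_const, Finset.card_univ, Fintype.card_pi, Finset.sum_sub_distrib,
    Finset.sum_add_distrib, Finset.sum_comm, ← Finset.mul_sum, Finset.sum_const,
    Finset.card_univ, Fintype.card_pi] at hsum
  simp only [Fintype.card_bool, Finset.prod_const, Finset.card_univ, Fintype.card_fin,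
    nsmul_eq_mul, Nat.cast_pow, Nat.cast_ofNat] at hsum
  have hchi : ∑ t, ∑ β, ∑ i, (S.stepProb (P β) t i - S.mixedProb t i) ^ 2 / S.mixedProb t i
      ≤ S.steps * (2 ^ M * (13 * (4 * ε) ^ 2 / 2 ^ n)) := by
    refine (Finset.sum_le_sum fun t _ => S.sum_chiSq_le e h0 h1 t).trans (le_of_eq ?_)
    rw [Finset.sum_const, Finset.card_univ, Fintype.card_fin, nsmul_eq_mul]
  have haB : a * ∑ β, δ β ≤ 2 ^ M * (2 / 3) := by
    refine (mul_le_mul_of_nonneg_left hδsum ha0.le).trans (le_of_eq ?_)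
    rw [ha]
    field_simp
  have h2M : (0 : ℝ) < 2 ^ M := by positivity
  have hfin : (2 : ℝ) ^ M * (2 / 3 * Real.log a + 1 / 3 * Real.log (1 / 3))
      ≤ 2 ^ M * (S.steps * (208 * ε ^ 2 / 2 ^ n)) := by
    refine hsum.trans ?_
    have : (S.steps : ℝ) * (2 ^ M * (13 * (4 * ε) ^ 2 / 2 ^ n))
        = 2 ^ M * (S.steps * (208 * ε ^ 2 / 2 ^ n)) := by ring
    linarith
  have hfin' := le_of_mul_le_mul_left hfin h2M
  rw [one_div, Real.log_inv] at hfin'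
  linarith

/-- The lower bound on the number of steps, whatever the number of uses of the channel in each
step. For one qubit there are two pairs of labels and a guess is right with probability `1 / 4`;
from two qubits on, the volume of Hamming balls is exponentially small. -/
theorem le_steps_of_learnsPauli {ε : ℝ} (hn : 1 ≤ n) (hε : 0 < ε) (hε4 : ε ≤ 1 / 4)
    (hL : S.LearnsPauli ε) : 1 / 60000 * ((2 : ℝ) ^ n) ^ 3 / ε ^ 2 ≤ S.steps := by
  have h0 : 0 ≤ 4 * ε := by linarith
  have h1 : 4 * ε ≤ 1 := by linarith
  have hlog : ∀ x : ℝ, 0 < x → 1 - x⁻¹ ≤ Real.log x := fun x hx => Real.one_sub_inv_le_log_of_pos hx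
  have hinfo : (4 : ℝ) ^ n / 96 ≤ 3 * (S.steps * (208 * ε ^ 2 / 2 ^ n)) := by
    rcases hn.eq_or_lt with rfl | hn
    · have e : Fin 2 × Bool ≃ PauliLabel 1 := Fintype.equivOfCardEq (by simp)
      have h := S.log_le_of_learnsPauli e hL hε h0 h1 (r := 0) (B := 1 / 4) (by norm_num)
        (by norm_num) (by norm_num) (fun β₀ => by
          have : (Finset.univ.filter fun β : Fin 2 → Bool => hammingDist β β₀ ≤ 0) = {β₀} := by
            ext β
            simp
          rw [this]
          norm_num)
      refine le_trans ?_ h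
      have h3 : 2 * Real.log (2 / (3 * (1 / 4))) - Real.log 3 = Real.log (64 / 27) := by
        rw [show (64 : ℝ) / 27 = (2 / (3 * (1 / 4))) ^ 2 / 3 by norm_num,
          Real.log_div (x := _ ^ 2) (by norm_num) (by norm_num), Real.log_pow]
        norm_num
      rw [h3]
      refine le_trans ?_ (hlog _ (by norm_num))
      norm_num
    · obtain ⟨m, rfl⟩ := Nat.exists_eq_add_of_le' hn
      -- Here `4 ^ n / 8 = 2 * 4 ^ m` is the radius `K`, and there are `4 * K` pairs of labels.
      obtain ⟨K, hK⟩ : ∃ K : ℕ, K = 2 * 4 ^ m := ⟨_, rfl⟩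
      have hKr : (4 : ℝ) ^ (m + 2) / 8 = K := by
        rw [hK]; push_cast; ring
      have hK2 : (2 : ℝ) ≤ K := by
        rw [hK]
        push_cast
        have : (1 : ℝ) ≤ 4 ^ m := one_le_pow₀ (by norm_num)
        linarith
      have e : Fin (4 * K) × Bool ≃ PauliLabel (m + 2) := Fintype.equivOfCardEq (by
        simp only [Fintype.card_prod, Fintype.card_fin, Fintype.card_bool, Fintype.card_pi,
          Finset.prod_const, Finset.card_univ, hK]
        ring)
      have h := S.log_le_of_learnsPauli e hL hε h0 h1 (r := K) (B := (16 / 27) ^ K)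
        (by rw [hKr]; linarith) (by positivity) (pow_le_one₀ (by norm_num) (by norm_num))
        (fun β₀ => by
          have hc := card_hammingBall_mul_le β₀ K
          have h3K : (0 : ℝ) < (1 / 3) ^ K := by positivity
          refine le_of_mul_le_mul_right (hc.trans (le_of_eq ?_)) h3K
          rw [pow_mul, pow_mul, ← mul_pow, ← mul_pow]
          norm_num)
      refine le_trans ?_ h
      have h3 : 2 * Real.log (2 / (3 * (16 / 27) ^ K)) - Real.log 3
          = Real.log (19683 / 16384) + (2 * K - 4) * Real.log (27 / 16) := by
        rw [show (2 : ℝ) / (3 * (16 / 27) ^ K) = 2 / 3 * (27 / 16) ^ K by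
            rw [div_pow, div_pow]; field_simp,
          Real.log_mul (by norm_num) (by positivity), Real.log_pow,
          show (19683 : ℝ) / 16384 = (2 / 3) ^ 2 * (27 / 16) ^ 4 / 3 by norm_num,
          Real.log_div (x := _ * _) (by norm_num) (by norm_num),
          Real.log_mul (x := (2 / 3) ^ 2) (by norm_num) (by norm_num), Real.log_pow, Real.log_pow]
        push_cast
        ring
      rw [h3]
      have l1 := hlog (19683 / 16384) (by norm_num)
      have l2 := hlog (27 / 16) (by norm_num)
      have l3 := mul_le_mul_of_nonneg_left l2 (show (0 : ℝ) ≤ 2 * K - 4 by linarith)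
      norm_num at l1 l3
      linarith
  have h2 : (0 : ℝ) < 2 ^ n := by positivity
  rw [← two_pow_mul_self] at hinfo
  rw [div_le_iff₀ (by positivity)]
  have h3 : 3 * ((S.steps : ℝ) * (208 * ε ^ 2 / 2 ^ n)) = 624 * (S.steps * ε ^ 2) / 2 ^ n := by ring
  rw [h3, le_div_iff₀ h2] at hinfo
  have h4 : (0 : ℝ) < (2 ^ n) ^ 3 := by positivity
  nlinarith

end NonadaptiveStrategy

/-! ### A spread of symmetric matrices over the field with two elements -/

/-- Symmetric matrices over `𝔽₂` whose graphs, together with the subspace `x = 0`, partition the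
nonzero vectors of `𝔽₂ⁿ × 𝔽₂ⁿ`. They are the Gram matrices of the forms `(x, y) ↦ ℓ (a x y)` on
the field with `2 ^ n` elements, for a nonzero linear functional `ℓ` and `a` in the field. -/
lemma exists_symmetric_spread (hn : n ≠ 0) :
    ∃ A : (Fin n → ZMod 2) → Matrix (Fin n) (Fin n) (ZMod 2),
      (∀ a, (A a).IsSymm) ∧ ∀ x z, x ≠ 0 → ∃! a, (A a).mulVec x = z := by
  have : Fact (Nat.Prime 2) := ⟨Nat.prime_two⟩
  set F := GaloisField 2 n
  let b : Module.Basis (Fin n) (ZMod 2) F :=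
    Module.finBasisOfFinrankEq (ZMod 2) F (GaloisField.finrank 2 hn)
  let i₀ : Fin n := ⟨0, Nat.pos_of_ne_zero hn⟩
  let ℓ : F →ₗ[ZMod 2] ZMod 2 := b.coord i₀
  let A : (Fin n → ZMod 2) → Matrix (Fin n) (Fin n) (ZMod 2) := fun a =>
    Matrix.of fun i j => ℓ (b.equivFun.symm a * (b i * b j))
  have hmul : ∀ a x i, (A a).mulVec x i = ℓ (b.equivFun.symm a * b.equivFun.symm x * b i) := by
    intro a x i
    have : b.equivFun.symm x = ∑ j, x j • b j := b.equivFun_symm_apply x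
    simp only [A, Matrix.mulVec, dotProduct, Matrix.of_apply]
    rw [this, Finset.mul_sum, Finset.sum_mul, map_sum]
    refine Finset.sum_congr rfl fun j _ => ?_
    rw [mul_smul_comm, smul_mul_assoc, map_smul, smul_eq_mul, mul_comm (x j)]
    congr 2
    ring
  refine ⟨A, fun a => ?_, fun x z hx => ?_⟩
  · ext i j
    simp only [A, Matrix.transpose_apply, Matrix.of_apply, mul_comm (b i)]
  · have hinj : Function.Injective fun a => (A a).mulVec x := by
      intro a a' h
      have h0 : ∀ i, ℓ ((b.equivFun.symm a - b.equivFun.symm a') * b.equivFun.symm x * b i) = 0 := by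
        intro i
        have h1 := congrFun h i
        simp only [hmul] at h1
        rw [sub_mul, sub_mul, map_sub, h1, sub_self]
      set c := (b.equivFun.symm a - b.equivFun.symm a') * b.equivFun.symm x with hc
      have hc0 : c = 0 := by
        by_contra hne
        have hall : ∀ y : F, ℓ (c * y) = 0 := by
          intro y
          have := b.ext (f₁ := ℓ ∘ₗ LinearMap.mulLeft (ZMod 2) c) (f₂ := 0) fun i => by simpa using h0 i
          exact LinearMap.congr_fun this y
        have h2 := hall (c⁻¹ * b i₀)
        rw [mul_inv_cancel_left₀ hne] at h2
        simp [ℓ] at h2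
      have hx' : b.equivFun.symm x ≠ 0 := (map_ne_zero_iff _ b.equivFun.symm.injective).mpr hx
      have h3 := (mul_eq_zero.mp hc0).resolve_right hx'
      exact b.equivFun.symm.injective (sub_eq_zero.mp h3)
    have hbij := Finite.injective_iff_bijective.mp hinj
    exact hbij.existsUnique z

/-! ### Pauli operators as shifts and signs -/

/-- The shift part of a Pauli label, with `X = (1, 0)`, `Y = (1, 1)` and `Z = (0, 1)`. -/
def xBits (s : PauliLabel n) : Fin n → ZMod 2 := fun k => (![0, 1, 1, 0] : Fin 4 → ZMod 2) (s k)

/-- The sign part of a Pauli label. -/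
def zBits (s : PauliLabel n) : Fin n → ZMod 2 := fun k => (![0, 0, 1, 1] : Fin 4 → ZMod 2) (s k)

lemma eq_of_xBits_eq_of_zBits_eq {s s' : PauliLabel n} (hx : xBits s = xBits s')
    (hz : zBits s = zBits s') : s = s' := by
  have key : ∀ a b : Fin 4, (![0, 1, 1, 0] : Fin 4 → ZMod 2) a = (![0, 1, 1, 0] : Fin 4 → ZMod 2) b →
      (![0, 0, 1, 1] : Fin 4 → ZMod 2) a = (![0, 0, 1, 1] : Fin 4 → ZMod 2) b → a = b := by decide
  funext k
  exact key _ _ (congrFun hx k) (congrFun hz k)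

/-- The additive character `t ↦ (-1) ^ t` of `𝔽₂`. -/
def signChar : AddChar (ZMod 2) ℂ := AddChar.zmodChar 2 (ζ := -1) (by norm_num)

/-- The additive character `t ↦ i ^ t` of `ℤ / 4`. -/
def quarticChar : AddChar (ZMod 4) ℂ := AddChar.zmodChar 4 (ζ := Complex.I) Complex.I_pow_four

lemma signChar_apply (t : ZMod 2) : signChar t = if t = 0 then 1 else -1 := by
  rcases (by decide : ∀ t : ZMod 2, t = 0 ∨ t = 1) t with rfl | rfl
  · simp
  · simp [signChar, AddChar.zmodChar_apply, ZMod.val_one]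

lemma signChar_sum {ι : Type*} (s : Finset ι) (f : ι → ZMod 2) :
    signChar (∑ i ∈ s, f i) = ∏ i ∈ s, signChar (f i) := by
  classical
  induction s using Finset.induction_on with
  | empty => simp
  | insert a s ha ih => rw [Finset.sum_insert ha, Finset.prod_insert ha, AddChar.map_add_eq_mul, ih]

lemma star_signChar (t : ZMod 2) : star (signChar t) = signChar t := by
  rw [signChar_apply]
  split_ifs <;> simp

lemma norm_signChar (t : ZMod 2) : ‖signChar t‖ = 1 := by
  rw [signChar, AddChar.zmodChar_apply]
  simp

lemma norm_quarticChar (t : ZMod 4) : ‖quarticChar t‖ = 1 := by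
  rw [quarticChar, AddChar.zmodChar_apply]
  simp

/-- The phase that relates a Pauli matrix to the product of a shift and a sign. -/
def pauliPhase : Fin 4 → ℂ := ![1, 1, Complex.I, 1]

lemma pauliMatrix_apply_fin (s : Fin 4) (a b : Fin 2) :
    pauliMatrix s a b = if a = b + (![0, 1, 1, 0] : Fin 4 → Fin 2) s then
      pauliPhase s * (if (![0, 0, 1, 1] : Fin 4 → Fin 2) s * b = 0 then 1 else -1) else 0 := by
  fin_cases s <;> fin_cases a <;> fin_cases b <;> simp [pauliMatrix, pauliPhase]

lemma pauliMatrix_apply (s : Fin 4) (a b : ZMod 2) :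
    pauliMatrix s a b = if a = b + (![0, 1, 1, 0] : Fin 4 → ZMod 2) s then
      pauliPhase s * signChar ((![0, 0, 1, 1] : Fin 4 → ZMod 2) s * b) else 0 := by
  rw [signChar_apply]
  exact pauliMatrix_apply_fin s a b

/-- The entries of a Pauli operator, indexed by vectors over `𝔽₂`. -/
def pauliEntry (s : PauliLabel n) (a b : Fin n → ZMod 2) : ℂ := pauliOp s a b

lemma pauliEntry_eq (s : PauliLabel n) (a b : Fin n → ZMod 2) :
    pauliEntry s a b = if a = b + xBits s then
      (∏ k, pauliPhase (s k)) * signChar (zBits s ⬝ᵥ b) else 0 := by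
  have h0 : pauliEntry s a b = ∏ k, pauliMatrix (s k) (a k) (b k) := rfl
  have h : ∀ k, pauliMatrix (s k) (a k) (b k) = if a k = (b + xBits s) k then
      pauliPhase (s k) * signChar (zBits s k * b k) else 0 := fun k => pauliMatrix_apply _ _ _
  simp only [h0, h, Finset.prod_ite_zero, Finset.prod_mul_distrib, dotProduct, funext_iff,
    signChar_sum, Finset.mem_univ, true_imp_iff]

lemma norm_prod_pauliPhase (s : PauliLabel n) : ‖∏ k, pauliPhase (s k)‖ = 1 := by
  have : ∀ t, ‖pauliPhase t‖ = 1 := by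
    intro t
    fin_cases t <;> simp [pauliPhase]
  rw [norm_prod]
  simp [this]

lemma sum_signChar_dotProduct (u : Fin n → ZMod 2) :
    ∑ v : Fin n → ZMod 2, signChar (u ⬝ᵥ v) = if u = 0 then (2 : ℂ) ^ n else 0 := by
  have h : ∀ t : ZMod 2, ∑ x, signChar (t * x) = if t = 0 then (2 : ℂ) else 0 := by
    intro t
    have : ∑ x : ZMod 2, signChar (t * x) = signChar (t * 0) + signChar (t * 1) :=
      Fin.sum_univ_two (M := ℂ) fun x => signChar (t * (show ZMod 2 from x))
    rw [this]
    rcases (by decide : ∀ t : ZMod 2, t = 0 ∨ t = 1) t with rfl | rfl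
    · simp; norm_num
    · simp [signChar_apply]
  simp only [dotProduct, signChar_sum]
  rw [← Fintype.prod_sum fun k x => signChar (u k * x)]
  simp only [h, prod_ite_two, funext_iff, Pi.zero_apply]

/-! ### Stabilizer bases -/

/-- The standard set-theoretic lift from `ℤ / 2` to `ℤ / 4`. -/
def liftFour (t : ZMod 2) : ZMod 4 := if t = 0 then 0 else 1

/-- Twice the lift is additive. -/
def twoLiftFour : ZMod 2 →+ ZMod 4 where
  toFun t := 2 * liftFour t
  map_zero' := by decide
  map_add' := by decide

lemma liftFour_add (s t : ZMod 2) :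
    liftFour (s + t) = liftFour s + liftFour t - 2 * (liftFour s * liftFour t) := by
  revert s t; decide

lemma liftFour_mul (s t : ZMod 2) : liftFour (s * t) = liftFour s * liftFour t := by
  revert s t; decide

lemma signChar_eq_quarticChar (t : ZMod 2) : signChar t = quarticChar (twoLiftFour t) := by
  have h1 : (twoLiftFour 1).val = 2 := by decide
  rcases (by decide : ∀ t : ZMod 2, t = 0 ∨ t = 1) t with rfl | rfl
  · simp
  · rw [quarticChar, AddChar.zmodChar_apply, h1, Complex.I_sq, signChar_apply]
    simp

/-- A symmetric bilinear form over `𝔽₂` is the polarization of a `ℤ / 4`-valued quadratic form,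
even if it is not alternating; `g` is `i` to the power of this quadratic form. -/
lemma exists_quadratic_phase {A : Matrix (Fin n) (Fin n) (ZMod 2)} (hA : A.IsSymm) :
    ∃ g : (Fin n → ZMod 2) → ℂ, (∀ v, ‖g v‖ = 1) ∧
      ∀ v x, g (v + x) = g v * g x * signChar (v ⬝ᵥ A.mulVec x) := by
  let Q : (Fin n → ZMod 2) → ZMod 4 := fun v =>
    ∑ i, ∑ j, liftFour (A i j) * (liftFour (v i) * liftFour (v j))
  refine ⟨fun v => quarticChar (Q v), fun v => norm_quarticChar _, fun v x => ?_⟩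
  have hB : twoLiftFour (v ⬝ᵥ A.mulVec x)
      = ∑ i, ∑ j, 2 * (liftFour (A i j) * (liftFour (v i) * liftFour (x j))) := by
    simp only [dotProduct, Matrix.mulVec, Finset.mul_sum, map_sum]
    refine Finset.sum_congr rfl fun i _ => Finset.sum_congr rfl fun j _ => ?_
    change 2 * liftFour (v i * (A i j * x j)) = _
    rw [liftFour_mul, liftFour_mul]
    ring
  rw [signChar_eq_quarticChar, ← AddChar.map_add_eq_mul, ← AddChar.map_add_eq_mul]
  refine congrArg quarticChar ?_
  rw [hB, ← sub_eq_zero]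
  -- The summand of the difference of the two sides is antisymmetric in `i` and `j`.
  let h : Fin n → Fin n → ZMod 4 := fun i j => liftFour (A i j) * (liftFour (x i) * liftFour (v j)
    - 2 * (liftFour (v i) * liftFour (x i)) * (liftFour (v j) + liftFour (x j)))
  have h4 : (4 : ZMod 4) = 0 := by decide
  have key : Q (v + x) - (Q v + Q x
      + ∑ i, ∑ j, 2 * (liftFour (A i j) * (liftFour (v i) * liftFour (x j))))
      = ∑ i, ∑ j, (h i j - h j i) := by
    simp only [Q, ← Finset.sum_add_distrib, ← Finset.sum_sub_distrib]
    refine Finset.sum_congr rfl fun i _ => Finset.sum_congr rfl fun j _ => ?_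
    simp only [h, Pi.add_apply, liftFour_add, hA.apply i j]
    linear_combination (liftFour (A i j) * (liftFour (v i) * liftFour (x i) * (liftFour (v j)
      * liftFour (x j)) - (liftFour (v j) * liftFour (x j)) * (liftFour (v i) + liftFour (x i)))) * h4
  rw [key]
  simp only [Finset.sum_sub_distrib]
  rw [Finset.sum_comm (f := fun i j => h j i), sub_self]

/-- The eigenbasis of the commuting Pauli operators with label `(x, A x)`; a Pauli operator with
label `(x, z)` shifts it by `z + A x`. -/
lemma exists_stabilizer_basis {A : Matrix (Fin n) (Fin n) (ZMod 2)} (hA : A.IsSymm) :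
    ∃ Ψ : Matrix (Fin n → ZMod 2) (Fin n → ZMod 2) ℂ, Ψ.conjTranspose * Ψ = 1 ∧
      ∀ s : PauliLabel n, ∃ c : ℂ, ‖c‖ = 1 ∧
      ∀ a, ∑ b, pauliEntry s a b * Ψ b 0 = c * Ψ a (zBits s + A.mulVec (xBits s)) := by
  have hadd : ∀ y : Fin n → ZMod 2, y + y = 0 := fun y =>
    funext fun i => CharTwo.add_self_eq_zero (y i)
  obtain ⟨g, hg1, hg⟩ := exists_quadratic_phase hA
  have hr : ((Real.sqrt (2 ^ n) : ℝ) : ℂ) * (Real.sqrt (2 ^ n) : ℝ) = 2 ^ n := by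
    rw [← Complex.ofReal_mul, Real.mul_self_sqrt (by positivity)]
    push_cast; rfl
  set r : ℂ := ((Real.sqrt (2 ^ n) : ℝ) : ℂ) with hrdef
  let Ψ : Matrix (Fin n → ZMod 2) (Fin n → ZMod 2) ℂ :=
    Matrix.of fun v w => r⁻¹ * (g v * signChar (w ⬝ᵥ v))
  have hΨ : Ψ.conjTranspose * Ψ = 1 := by
    ext w w'
    have h : ∀ v, star (Ψ v w) * Ψ v w' = (2 ^ n : ℂ)⁻¹ * signChar ((w + w') ⬝ᵥ v) := by
      intro v
      simp only [Ψ, Matrix.of_apply, star_mul', star_signChar, add_dotProduct,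
        AddChar.map_add_eq_mul]
      have hgv : star (g v) * g v = 1 := by
        rw [RCLike.star_def, Complex.conj_mul', hg1]
        simp
      have hrs : star r⁻¹ = r⁻¹ := by
        rw [hrdef, RCLike.star_def, map_inv₀, Complex.conj_ofReal]
      rw [hrs, ← hr, mul_inv]
      linear_combination (r⁻¹ * r⁻¹ * signChar (w ⬝ᵥ v) * signChar (w' ⬝ᵥ v)) * hgv
    have hww : w + w' = 0 ↔ w = w' :=
      ⟨fun h => add_right_cancel (h.trans (hadd w').symm), fun h => h ▸ hadd w⟩
    simp only [Matrix.mul_apply, Matrix.conjTranspose_apply, h]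
    rw [← Finset.mul_sum, sum_signChar_dotProduct, Matrix.one_apply]
    simp only [hww]
    split_ifs <;> simp
  refine ⟨Ψ, hΨ, fun s => ⟨(∏ k, pauliPhase (s k)) * signChar (zBits s ⬝ᵥ xBits s)
    * g (xBits s), ?_, fun a => ?_⟩⟩
  · rw [norm_mul, norm_mul, norm_prod_pauliPhase, norm_signChar, hg1]
    norm_num
  · have hab : ∀ b : Fin n → ZMod 2, a = b + xBits s ↔ b = a + xBits s := by
      intro b
      have h2 : ∀ y : Fin n → ZMod 2, y + xBits s + xBits s = y := by
        intro y
        rw [add_assoc, hadd, add_zero]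
      constructor
      · rintro rfl; rw [h2]
      · rintro rfl; rw [h2]
    have hs : ∑ b : Fin n → ZMod 2, pauliEntry s a b * Ψ b 0
        = (∏ k, pauliPhase (s k)) * signChar (zBits s ⬝ᵥ (a + xBits s))
          * Ψ (a + xBits s) 0 := by
      have h (b : Fin n → ZMod 2) : pauliEntry s a b * Ψ b 0 = if b = a + xBits s then
          (∏ k, pauliPhase (s k)) * signChar (zBits s ⬝ᵥ b) * Ψ b 0 else 0 := by
        rw [pauliEntry_eq]
        simp only [hab b, ite_mul, zero_mul]
      simp only [h]
      rw [Finset.sum_ite_eq' Finset.univ (a + xBits s)]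
      simp
    refine hs.trans ?_
    have hcomm : a ⬝ᵥ A.mulVec (xBits s) = A.mulVec (xBits s) ⬝ᵥ a := dotProduct_comm _ _
    simp only [Ψ, Matrix.of_apply, hg, hcomm, zero_dotProduct, AddChar.map_zero_eq_one,
      dotProduct_add, add_dotProduct, AddChar.map_add_eq_mul]
    ring

lemma exists_computational_basis :
    ∃ Ψ : Matrix (Fin n → ZMod 2) (Fin n → ZMod 2) ℂ, Ψ.conjTranspose * Ψ = 1 ∧
      ∀ s : PauliLabel n, ∃ c : ℂ, ‖c‖ = 1 ∧
      ∀ a, ∑ b, pauliEntry s a b * Ψ b 0 = c * Ψ a (xBits s) := by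
  refine ⟨1, by simp, fun s => ⟨∏ k, pauliPhase (s k), norm_prod_pauliPhase s, fun a => ?_⟩⟩
  have h : ∑ b, pauliEntry s a b * (1 : Matrix (Fin n → ZMod 2) (Fin n → ZMod 2) ℂ) b 0
      = pauliEntry s a 0 := by
    simp [Matrix.one_apply]
  rw [h, pauliEntry_eq]
  simp only [zero_add, dotProduct_zero, AddChar.map_zero_eq_one, mul_one, Matrix.one_apply,
    mul_ite, mul_zero]

/-- The outcome of measuring the basis number `j` after the Pauli operator `s`. The label `none`
stands for the computational basis. -/
def syndrome (A : (Fin n → ZMod 2) → Matrix (Fin n) (Fin n) (ZMod 2)) :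
    Option (Fin n → ZMod 2) → PauliLabel n → Fin n → ZMod 2
  | none, s => xBits s
  | some a, s => zBits s + (A a).mulVec (xBits s)

/-- The Pauli labels are the points and the fibres of the syndromes are the lines of an affine
plane: two points lie on one line. -/
lemma existsUnique_syndrome_eq {A : (Fin n → ZMod 2) → Matrix (Fin n) (Fin n) (ZMod 2)}
    (hA : ∀ x z, x ≠ 0 → ∃! a, (A a).mulVec x = z) {s s' : PauliLabel n} (hs : s ≠ s') :
    ∃! j, syndrome A j s = syndrome A j s' := by
  by_cases hx : xBits s = xBits s'
  · refine ⟨none, hx, ?_⟩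
    rintro (_ | a) h
    · rfl
    · refine absurd (eq_of_xBits_eq_of_zBits_eq hx ?_) hs
      have h' : zBits s + (A a).mulVec (xBits s) = zBits s' + (A a).mulVec (xBits s') := h
      rw [hx] at h'
      exact add_right_cancel h'
  · have key : ∀ a, syndrome A (some a) s = syndrome A (some a) s' ↔
        (A a).mulVec (xBits s - xBits s') = zBits s' - zBits s := by
      intro a
      change zBits s + (A a).mulVec (xBits s) = zBits s' + (A a).mulVec (xBits s') ↔ _
      rw [Matrix.mulVec_sub, sub_eq_sub_iff_add_eq_add, add_comm (zBits s), eq_comm]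
    obtain ⟨a, ha, huniq⟩ := hA (xBits s - xBits s') (zBits s' - zBits s) (sub_ne_zero.mpr hx)
    refine ⟨some a, (key a).mpr ha, ?_⟩
    rintro (_ | a') h
    · exact absurd h hx
    · rw [huniq a' ((key a').mp h)]

/-- For each syndrome there is an orthonormal basis, given by the columns of `Ψ`, whose first
vector is mapped by the Pauli operator `s` to the vector numbered by the syndrome of `s`. -/
lemma exists_syndrome_basis {A : (Fin n → ZMod 2) → Matrix (Fin n) (Fin n) (ZMod 2)}
    (hA : ∀ a, (A a).IsSymm) (j : Option (Fin n → ZMod 2)) :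
    ∃ Ψ : QMat n, Ψ.conjTranspose * Ψ = 1 ∧ ∀ s : PauliLabel n, ∃ c : ℂ, ‖c‖ = 1 ∧
      ∀ a, ∑ b, pauliOp s a b * Ψ b 0 = c * Ψ a (syndrome A j s) := by
  cases j with
  | none => exact exists_computational_basis
  | some a => exact exists_stabilizer_basis (hA a)

/-- A complete design of measurements: syndromes `σ j` that form an affine plane, and bases `Ψ j`
that measure them. -/
lemma exists_measurement_design (hn : n ≠ 0) :
    ∃ (σ : Option (Qubits n) → PauliLabel n → Qubits n) (Ψ : Option (Qubits n) → QMat n),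
      (∀ s s', s ≠ s' → ∃! j, σ j s = σ j s') ∧
      ∀ j, (Ψ j).conjTranspose * Ψ j = 1 ∧ ∀ s : PauliLabel n, ∃ c : ℂ, ‖c‖ = 1 ∧
        ∀ a, ∑ b, pauliOp s a b * Ψ j b 0 = c * Ψ j a (σ j s) := by
  obtain ⟨A, hsymm, hA⟩ := exists_symmetric_spread hn
  choose Ψ hΨ using fun j => exists_syndrome_basis hsymm j
  exact ⟨syndrome A, Ψ, fun s s' hs => existsUnique_syndrome_eq hA hs, hΨ⟩

/-! ### Measuring syndromes -/

/-- The rank-one projection on the column `w` of `Ψ`. -/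
def colProj (Ψ : QMat n) (w : Qubits n) : QMat n :=
  Matrix.vecMulVec (fun a => Ψ a w) (star fun a => Ψ a w)

lemma colProj_posSemidef (Ψ : QMat n) (w : Qubits n) : (colProj Ψ w).PosSemidef :=
  Matrix.posSemidef_vecMulVec_self_star _

lemma sum_colProj {Ψ : QMat n} (hΨ : Ψ.conjTranspose * Ψ = 1) : ∑ w, colProj Ψ w = 1 := by
  rw [← mul_eq_one_comm.mp hΨ]
  ext a b
  simp [colProj, Matrix.sum_apply, Matrix.vecMulVec_apply, Matrix.mul_apply]

lemma trace_colProj_mul_colProj {Ψ : QMat n} (hΨ : Ψ.conjTranspose * Ψ = 1) (v w : Qubits n) :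
    (colProj Ψ v * colProj Ψ w).trace = if v = w then 1 else 0 := by
  have h : ∀ v w, (star fun a => Ψ a v) ⬝ᵥ (fun a => Ψ a w) = (1 : QMat n) v w := by
    intro v w
    rw [← hΨ, Matrix.mul_apply]
    rfl
  rw [colProj, colProj, Matrix.vecMulVec_mul_vecMulVec, Matrix.trace_vecMulVec, h,
    dotProduct_smul, dotProduct_comm, h, Matrix.one_apply, Matrix.one_apply]
  by_cases hvw : v = w <;> simp [hvw, eq_comm]

lemma trace_colProj {Ψ : QMat n} (hΨ : Ψ.conjTranspose * Ψ = 1) (w : Qubits n) :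
    (colProj Ψ w).trace = 1 := by
  have h := congrFun (congrFun hΨ w) w
  rw [Matrix.mul_apply, Matrix.one_apply_eq] at h
  rw [colProj, Matrix.trace_vecMulVec, dotProduct_comm, ← h]
  rfl

lemma pauliOp_conj_colProj {Ψ : QMat n} {s : PauliLabel n} {w : Qubits n} {c : ℂ} (hc : ‖c‖ = 1)
    (h : ∀ a, ∑ b, pauliOp s a b * Ψ b 0 = c * Ψ a w) :
    pauliOp s * colProj Ψ 0 * pauliOp s = colProj Ψ w := by
  have h1 : (pauliOp s).mulVec (fun a => Ψ a 0) = c • fun a => Ψ a w := funext h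
  have h2 : Matrix.vecMul (star fun a => Ψ a 0) (pauliOp s) = star (c • fun a => Ψ a w) := by
    rw [← h1, Matrix.star_mulVec, pauliOp_conjTranspose]
  rw [colProj, Matrix.mul_vecMulVec, Matrix.vecMulVec_mul, h1, h2, star_smul, Matrix.smul_vecMulVec,
    Matrix.vecMulVec_smul, smul_smul, RCLike.star_def, Complex.mul_conj', hc]
  simp [colProj]

/-- The probability of the value `w` of the syndrome `σ` under the distribution `p`. -/
def syndromeProb (σ : PauliLabel n → Qubits n) (p : PauliDist n) (w : Qubits n) : ℝ :=
  ∑ s, p.1 s * if σ s = w then 1 else 0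

lemma syndromeProb_nonneg (σ : PauliLabel n → Qubits n) (p : PauliDist n) (w : Qubits n) :
    0 ≤ syndromeProb σ p w :=
  Finset.sum_nonneg fun s _ => mul_nonneg (p.2.1 s) (by split_ifs <;> norm_num)

lemma sum_syndromeProb (σ : PauliLabel n → Qubits n) (p : PauliDist n) :
    ∑ w, syndromeProb σ p w = 1 := by
  simp only [syndromeProb]
  rw [Finset.sum_comm]
  simp only [← Finset.mul_sum]
  simp [p.2.2]

lemma trace_pauliChannel_colProj_mul {Ψ : QMat n} (hΨ : Ψ.conjTranspose * Ψ = 1)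
    {σ : PauliLabel n → Qubits n}
    (h : ∀ s, ∃ c : ℂ, ‖c‖ = 1 ∧ ∀ a, ∑ b, pauliOp s a b * Ψ b 0 = c * Ψ a (σ s))
    (p : PauliDist n) (w : Qubits n) :
    (pauliChannel p (colProj Ψ 0) * colProj Ψ w).trace.re = syndromeProb σ p w := by
  rw [pauliChannel_eq_pauliMap, pauliMap_apply, Finset.sum_mul, Matrix.trace_sum, Complex.re_sum,
    syndromeProb]
  refine Finset.sum_congr rfl fun s _ => ?_
  obtain ⟨c, hc, hcol⟩ := h s
  rw [pauliOp_conj_colProj hc hcol, smul_mul_assoc, Matrix.trace_smul,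
    trace_colProj_mul_colProj hΨ, smul_eq_mul, Complex.re_ofReal_mul]
  split_ifs <;> simp

/-- Inversion of the incidence matrix of the affine plane: every other point is on exactly one of
the `d + 1` lines through `s`. -/
lemma sum_syndromeProb_syndrome {σ : Option (Qubits n) → PauliLabel n → Qubits n}
    (hσ : ∀ s s', s ≠ s' → ∃! j, σ j s = σ j s') (p : PauliDist n) (s : PauliLabel n) :
    ∑ j, syndromeProb (σ j) p (σ j s) = 2 ^ n * p.1 s + 1 := by
  simp only [syndromeProb]
  rw [Finset.sum_comm]
  have h : ∀ s', ∑ j, p.1 s' * (if σ j s' = σ j s then (1 : ℝ) else 0)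
      = p.1 s' + (if s' = s then 2 ^ n * p.1 s else 0) := by
    intro s'
    rw [← Finset.mul_sum]
    by_cases hs : s' = s
    · subst hs
      simp
      ring
    · obtain ⟨j, hj, hu⟩ := hσ s' s hs
      rw [Finset.sum_eq_single j (fun j' _ hj' => if_neg fun h => hj' (hu j' h)) (by simp),
        if_pos hj, if_neg hs]
      ring
  simp only [h, Finset.sum_add_distrib, p.2.2]
  simp
  ring

/-! ### The tomography strategy -/

/-- The variance of a sum of independent centred variables. -/
lemma sum_prod_mul_sq_sum {N : ℕ} {k : Fin N → ℕ} {w : (t : Fin N) → Fin (k t) → ℝ}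
    (hw : ∀ t, ∑ i, w t i = 1) (f : (t : Fin N) → Fin (k t) → ℝ)
    (hf : ∀ t, ∑ i, w t i * f t i = 0) :
    ∑ o : (t : Fin N) → Fin (k t), (∏ t, w t (o t)) * (∑ t, f t (o t)) ^ 2
      = ∑ t, ∑ i, w t i * f t i ^ 2 := by
  have h : ∀ o : (t : Fin N) → Fin (k t), (∏ t, w t (o t)) * (∑ t, f t (o t)) ^ 2
      = ∑ t, ∑ t', (∏ t, w t (o t)) * (f t (o t) * f t' (o t')) := by
    intro o
    rw [sq, Finset.sum_mul_sum, Finset.mul_sum]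
    exact Finset.sum_congr rfl fun t _ => Finset.mul_sum _ _ _
  simp only [h]
  rw [Finset.sum_comm]
  refine Finset.sum_congr rfl fun t _ => ?_
  rw [Finset.sum_comm, Finset.sum_eq_single t]
  · simp only [← sq]
    exact sum_prod_mul_apply hw (fun t i => f t i ^ 2) t
  · intro t' _ ht'
    rw [sum_prod_mul_apply_mul_apply hw f ht'.symm, hf, zero_mul]
  · simp

section Tomography

variable (σ : Option (Qubits n) → PauliLabel n → Qubits n) {N R : ℕ}
  (τ : Fin N ≃ Option (Qubits n) × Fin R) (ω : Fin (2 ^ n) ≃ Qubits n)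

/-- The linear estimate of the Pauli error rates. The step `t` measures the basis `(τ t).1`, each
basis is measured `R` times, and `ω` enumerates the outcomes. -/
def linearEstimate (o : Fin N → Fin (2 ^ n)) (s : PauliLabel n) : ℝ :=
  ((∑ t, if ω (o t) = σ (τ t).1 s then (1 : ℝ) else 0) / R - 1) / 2 ^ n

variable {σ}

lemma sum_prod_mul_linearEstimate_sub_sq_le (hσ : ∀ s s', s ≠ s' → ∃! j, σ j s = σ j s')
    (hR : 0 < R) (p : PauliDist n) (s : PauliLabel n) :
    ∑ o : Fin N → Fin (2 ^ n), (∏ t, syndromeProb (σ (τ t).1) p (ω (o t)))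
      * (linearEstimate σ τ ω o s - p.1 s) ^ 2 ≤ (2 ^ n * p.1 s + 1) / (4 ^ n * R) := by
  have hR' : (0 : ℝ) < R := by exact_mod_cast hR
  let m : Fin N → ℝ := fun t => syndromeProb (σ (τ t).1) p (σ (τ t).1 s)
  let f : Fin N → Fin (2 ^ n) → ℝ := fun t i =>
    (if ω i = σ (τ t).1 s then (1 : ℝ) else 0) - m t
  have hsum : ∑ t, m t = R * (2 ^ n * p.1 s + 1) := by
    rw [← τ.symm.sum_comp, Fintype.sum_prod_type]
    simp only [m, Equiv.apply_symm_apply, Finset.sum_const, Finset.card_univ, Fintype.card_fin,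
      nsmul_eq_mul]
    rw [← Finset.mul_sum, sum_syndromeProb_syndrome hσ]
  have hw : ∀ t, ∑ i, syndromeProb (σ (τ t).1) p (ω i) = 1 := by
    intro t
    rw [ω.sum_comp fun w => syndromeProb (σ (τ t).1) p w, sum_syndromeProb]
  have hw1 : ∀ t, ∑ i, syndromeProb (σ (τ t).1) p (ω i) * (if ω i = σ (τ t).1 s then (1 : ℝ) else 0)
      = m t := by
    intro t
    rw [ω.sum_comp fun w => syndromeProb (σ (τ t).1) p w * (if w = σ (τ t).1 s then (1 : ℝ) else 0)]
    simp [m]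
  have hf : ∀ t, ∑ i, syndromeProb (σ (τ t).1) p (ω i) * f t i = 0 := by
    intro t
    simp only [f, mul_sub, Finset.sum_sub_distrib, hw1, ← Finset.sum_mul, hw, one_mul, sub_self]
  have hf2 : ∀ t, ∑ i, syndromeProb (σ (τ t).1) p (ω i) * f t i ^ 2 ≤ m t := by
    intro t
    have h : ∀ i, syndromeProb (σ (τ t).1) p (ω i) * f t i ^ 2
        = (1 - 2 * m t) * (syndromeProb (σ (τ t).1) p (ω i)
            * (if ω i = σ (τ t).1 s then (1 : ℝ) else 0))
          + m t ^ 2 * syndromeProb (σ (τ t).1) p (ω i) := by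
      intro i
      simp only [f]
      split_ifs <;> ring
    simp only [h, Finset.sum_add_distrib, ← Finset.mul_sum, hw1, hw]
    nlinarith [sq_nonneg (m t)]
  have herr : ∀ o : Fin N → Fin (2 ^ n), linearEstimate σ τ ω o s - p.1 s
      = (∑ t, f t (o t)) / (2 ^ n * R) := by
    intro o
    simp only [f, Finset.sum_sub_distrib, hsum, linearEstimate]
    field_simp
    ring
  simp only [herr, div_pow, mul_div_assoc']
  rw [← Finset.sum_div, sum_prod_mul_sq_sum (k := fun _ => 2 ^ n) hw f hf,
    div_le_div_iff₀ (by positivity) (by positivity)]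
  have h1 : ∑ t, ∑ i, syndromeProb (σ (τ t).1) p (ω i) * f t i ^ 2 ≤ R * (2 ^ n * p.1 s + 1) :=
    (Finset.sum_le_sum fun t _ => hf2 t).trans hsum.le
  calc _ ≤ R * (2 ^ n * p.1 s + 1) * (4 ^ n * R) := by gcongr
    _ = _ := by rw [← two_pow_mul_self]; ring

/-- The mean squared `ℓ¹` error of the linear estimate. -/
lemma sum_prod_mul_sq_sum_abs_le (hσ : ∀ s s', s ≠ s' → ∃! j, σ j s = σ j s')
    (hR : 0 < R) (p : PauliDist n) :
    ∑ o : Fin N → Fin (2 ^ n), (∏ t, syndromeProb (σ (τ t).1) p (ω (o t)))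
      * (∑ s, |linearEstimate σ τ ω o s - p.1 s|) ^ 2 ≤ 2 * 4 ^ n / R := by
  have hR' : (0 : ℝ) < R := by exact_mod_cast hR
  have hcs : ∀ o, (∑ s, |linearEstimate σ τ ω o s - p.1 s|) ^ 2
      ≤ 4 ^ n * ∑ s, (linearEstimate σ τ ω o s - p.1 s) ^ 2 := by
    intro o
    have h := sq_sum_le_card_mul_sum_sq (s := Finset.univ)
      (f := fun s => |linearEstimate σ τ ω o s - p.1 s|)
    simpa only [sq_abs, Finset.card_univ, Fintype.card_pi, Fintype.card_fin, Finset.prod_const,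
      Nat.cast_pow, Nat.cast_ofNat] using h
  calc _ ≤ ∑ o : Fin N → Fin (2 ^ n), (∏ t, syndromeProb (σ (τ t).1) p (ω (o t)))
        * (4 ^ n * ∑ s, (linearEstimate σ τ ω o s - p.1 s) ^ 2) :=
        Finset.sum_le_sum fun o _ => mul_le_mul_of_nonneg_left (hcs o)
          (Finset.prod_nonneg fun t _ => syndromeProb_nonneg _ _ _)
    _ = 4 ^ n * ∑ s, ∑ o : Fin N → Fin (2 ^ n), (∏ t, syndromeProb (σ (τ t).1) p (ω (o t)))
        * (linearEstimate σ τ ω o s - p.1 s) ^ 2 := by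
        rw [Finset.sum_comm, Finset.mul_sum]
        refine Finset.sum_congr rfl fun o _ => ?_
        rw [← Finset.mul_sum]
        ring
    _ ≤ 4 ^ n * ∑ s, (2 ^ n * p.1 s + 1) / (4 ^ n * R) := by
        gcongr with s
        exact sum_prod_mul_linearEstimate_sub_sq_le τ ω hσ hR p s
    _ = (2 ^ n + 4 ^ n) / R := by
        rw [← Finset.sum_div, Finset.sum_add_distrib, ← Finset.mul_sum, p.2.2]
        simp
        field_simp
    _ ≤ 2 * 4 ^ n / R := by
        have : (2 : ℝ) ^ n ≤ 4 ^ n := pow_le_pow_left₀ (by norm_num) (by norm_num) n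
        gcongr
        linarith

open Classical in
/-- A distribution that is within `ε / 2` of the linear estimate, if there is one. -/
def roundedEstimate (q₀ : PauliDist n) (ε : ℝ) (x : PauliLabel n → ℝ) : PauliDist n :=
  if h : ∃ q : PauliDist n, ∑ s, |x s - q.1 s| ≤ ε / 2 then h.choose else q₀

lemma sum_abs_sub_roundedEstimate_le (q₀ : PauliDist n) {ε : ℝ} {x : PauliLabel n → ℝ}
    {p : PauliDist n} (h : ∑ s, |x s - p.1 s| ≤ ε / 2) :
    ∑ s, |p.1 s - (roundedEstimate q₀ ε x).1 s| ≤ ε := by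
  have hex : ∃ q : PauliDist n, ∑ s, |x s - q.1 s| ≤ ε / 2 := ⟨p, h⟩
  have hq : ∑ s, |x s - (roundedEstimate q₀ ε x).1 s| ≤ ε / 2 := by
    rw [roundedEstimate, dif_pos hex]
    exact hex.choose_spec
  calc _ ≤ ∑ s, (|x s - p.1 s| + |x s - (roundedEstimate q₀ ε x).1 s|) := by
        refine Finset.sum_le_sum fun s _ => ?_
        rw [abs_sub_comm (x s) (p.1 s)]
        exact abs_sub_le _ _ _
    _ ≤ ε := by rw [Finset.sum_add_distrib]; linarith

/-- The strategy that measures the syndrome of each of the bases `Ψ j` repeatedly. -/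
def tomography {Ψ : Option (Qubits n) → QMat n} (hΨ : ∀ j, (Ψ j).conjTranspose * Ψ j = 1)
    (σ : Option (Qubits n) → PauliLabel n → Qubits n) (q₀ : PauliDist n) (ε : ℝ) :
    NonadaptiveStrategy n where
  steps := N
  input t := colProj (Ψ (τ t).1) 0
  input_posSemidef t := colProj_posSemidef _ _
  input_trace t := trace_colProj (hΨ _) _
  interleaved _ := []
  interleaved_unital t Φ h := by simp at h
  outcomes _ := 2 ^ n
  povm t i := colProj (Ψ (τ t).1) (ω i)
  povm_posSemidef t i := colProj_posSemidef _ _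
  povm_sum t := by rw [ω.sum_comp fun w => colProj (Ψ (τ t).1) w, sum_colProj (hΨ _)]
  estimate o := PMF.pure (roundedEstimate q₀ ε (linearEstimate σ τ ω o))

lemma tomography_learnsPauli {Ψ : Option (Qubits n) → QMat n}
    (hΨ : ∀ j, (Ψ j).conjTranspose * Ψ j = 1)
    (hσ : ∀ s s', s ≠ s' → ∃! j, σ j s = σ j s')
    (hΨσ : ∀ j s, ∃ c : ℂ, ‖c‖ = 1 ∧ ∀ a, ∑ b, pauliOp s a b * Ψ j b 0 = c * Ψ j a (σ j s))
    (q₀ : PauliDist n) {ε : ℝ} (hε : 0 < ε) (hR : 24 * 4 ^ n / ε ^ 2 ≤ R) :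
    (tomography τ ω hΨ σ q₀ ε).LearnsPauli ε := by
  classical
  intro p
  have hR' : (0 : ℝ) < R := lt_of_lt_of_le (by positivity) hR
  have hprob : ∀ o, (tomography τ ω hΨ σ q₀ ε).outcomeProb (pauliChannel p) o
      = ∏ t, syndromeProb (σ (τ t).1) p (ω (o t)) := fun o =>
    Finset.prod_congr rfl fun t _ => trace_pauliChannel_colProj_mul (hΨ _) (hΨσ _) p _
  set W : (Fin N → Fin (2 ^ n)) → ℝ := fun o => ∏ t, syndromeProb (σ (τ t).1) p (ω (o t)) with hW
  have hW0 : ∀ o, 0 ≤ W o := fun o => Finset.prod_nonneg fun t _ => syndromeProb_nonneg _ _ _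
  have hW1 : ∑ o, W o = 1 := by
    refine sum_prod_eq_one (k := fun _ : Fin N => 2 ^ n)
      (w := fun t i => syndromeProb (σ (τ t).1) p (ω i)) fun t => ?_
    rw [ω.sum_comp fun w => syndromeProb (σ (τ t).1) p w, sum_syndromeProb]
  set D : (Fin N → Fin (2 ^ n)) → ℝ := fun o => ∑ s, |linearEstimate σ τ ω o s - p.1 s| with hD
  -- Chebyshev: the estimate fails only where `1 ≤ (2 D / ε) ^ 2`.
  have hsucc : ∀ o, W o * (1 - 4 / ε ^ 2 * D o ^ 2)
      ≤ W o * ((PMF.pure (roundedEstimate q₀ ε (linearEstimate σ τ ω o))).toOuterMeasure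
          {q | diamondDist (pauliChannel p) (pauliChannel q) ≤ ε}).toReal := by
    intro o
    refine mul_le_mul_of_nonneg_left ?_ (hW0 o)
    rw [PMF.toOuterMeasure_pure_apply]
    by_cases hclose : D o ≤ ε / 2
    · rw [if_pos]
      · have : 0 ≤ 4 / ε ^ 2 * D o ^ 2 := by positivity
        simpa using this
      · rw [Set.mem_ofPred_eq, diamondDist_pauliChannel]
        exact sum_abs_sub_roundedEstimate_le q₀ hclose
    · push Not at hclose
      have h1 : 1 ≤ 4 / ε ^ 2 * D o ^ 2 := by
        rw [div_mul_eq_mul_div, le_div_iff₀ (by positivity)]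
        nlinarith
      exact le_trans (by linarith) ENNReal.toReal_nonneg
  refine le_trans ?_ (Finset.sum_le_sum fun o _ => (hsucc o).trans
    (mul_le_mul_of_nonneg_right (hprob o).ge ENNReal.toReal_nonneg))
  have hvar : ∑ o, W o * D o ^ 2 ≤ 2 * 4 ^ n / R :=
    sum_prod_mul_sq_sum_abs_le τ ω hσ (by exact_mod_cast hR') p
  have hsum : ∑ o, W o * (1 - 4 / ε ^ 2 * D o ^ 2) = 1 - 4 / ε ^ 2 * ∑ o, W o * D o ^ 2 := by
    rw [Finset.mul_sum]
    simp only [mul_sub, mul_one, Finset.sum_sub_distrib, hW1]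
    exact congrArg (1 - ·) (Finset.sum_congr rfl fun o _ => by ring)
  have hfail : 4 / ε ^ 2 * (2 * 4 ^ n / R) ≤ 1 / 3 := by
    rw [div_le_iff₀ (by positivity)] at hR
    rw [div_mul_div_comm, div_le_iff₀ (by positivity)]
    linarith
  have := mul_le_mul_of_nonneg_left hvar (show 0 ≤ 4 / ε ^ 2 by positivity)
  change 2 / 3 ≤ ∑ o, W o * (1 - 4 / ε ^ 2 * D o ^ 2)
  rw [hsum]
  linarith

end Tomography

/-- The upper bound on the number of measurements, without a factor `log d`. -/
theorem exists_learnsPauli {ε : ℝ} (hn : 1 ≤ n) (hε : 0 < ε) (hε4 : ε ≤ 1 / 4) :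
    ∃ S : NonadaptiveStrategy n, S.LearnsPauli ε ∧ (∀ t, S.uses t = 1) ∧
      (S.steps : ℝ) ≤ 50 * ((2 : ℝ) ^ n) ^ 3 / ε ^ 2 := by
  obtain ⟨σ, Ψ, hσ, hΨ⟩ := exists_measurement_design (n := n) (by omega)
  obtain ⟨R, hR⟩ : ∃ R, R = ⌈24 * (4 : ℝ) ^ n / ε ^ 2⌉₊ := ⟨_, rfl⟩
  have hR1 : 24 * (4 : ℝ) ^ n / ε ^ 2 ≤ R := hR ▸ Nat.le_ceil _
  have hR2 : (R : ℝ) ≤ 25 * 4 ^ n / ε ^ 2 := by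
    have h1 : (R : ℝ) < 24 * 4 ^ n / ε ^ 2 + 1 := hR ▸ Nat.ceil_lt_add_one (by positivity)
    have h2 : 1 ≤ (4 : ℝ) ^ n / ε ^ 2 := by
      rw [le_div_iff₀ (by positivity), one_mul]
      exact (pow_le_one₀ hε.le (by linarith)).trans (one_le_pow₀ (by norm_num))
    have h3 : 25 * (4 : ℝ) ^ n / ε ^ 2 = 24 * 4 ^ n / ε ^ 2 + 4 ^ n / ε ^ 2 := by ring
    linarith
  let τ : Fin ((2 ^ n + 1) * R) ≃ Option (Qubits n) × Fin R :=
    (Fintype.equivFinOfCardEq (by simp)).symm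
  let ω : Fin (2 ^ n) ≃ Qubits n := (Fintype.equivFinOfCardEq (by simp)).symm
  let q₀ : PauliDist n := ⟨Pi.single 0 1, single_mem_stdSimplex ℝ 0⟩
  refine ⟨tomography τ ω (fun j => (hΨ j).1) σ q₀ ε,
    tomography_learnsPauli τ ω _ hσ (fun j => (hΨ j).2) q₀ hε hR1, fun t => rfl, ?_⟩
  have hd : (1 : ℝ) ≤ 2 ^ n := one_le_pow₀ (by norm_num)
  change (((2 ^ n + 1) * R : ℕ) : ℝ) ≤ _
  push_cast
  calc ((2 : ℝ) ^ n + 1) * R ≤ (2 ^ n + 2 ^ n) * (25 * 4 ^ n / ε ^ 2) := by gcongr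
    _ = 50 * ((2 : ℝ) ^ n) ^ 3 / ε ^ 2 := by rw [← two_pow_mul_self]; ring

end

/-! ### The number of measurements in Pauli channel tomography -/

theorem mainTheorem2 :
    (∃ c : ℝ, 0 < c ∧
      ∀ (n : ℕ) (ε : ℝ), 1 ≤ n → 0 < ε → ε ≤ 1 / 4 →
        ∀ S : NonadaptiveStrategy n, S.LearnsPauli ε →
          c * ((2 : ℝ) ^ n) ^ 3 / ε ^ 2 ≤ (S.steps : ℝ) ∨
          c * ((2 : ℝ) ^ n) ^ 4 / ε ^ 6 ≤ ((∑ t, S.uses t : ℕ) : ℝ)) ∧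
    (∃ C : ℝ, 0 < C ∧
      ∀ (n : ℕ) (ε : ℝ), 1 ≤ n → 0 < ε → ε ≤ 1 / 4 →
        ∃ S : NonadaptiveStrategy n, S.LearnsPauli ε ∧ (∀ t, S.uses t = 1) ∧
          (S.steps : ℝ) ≤ C * ((2 : ℝ) ^ n) ^ 3 * Real.log ((2 : ℝ) ^ n) / ε ^ 2) := by
  refine ⟨⟨1 / 60000, by norm_num, fun n ε hn hε hε4 S hL =>
    Or.inl (S.le_steps_of_learnsPauli hn hε hε4 hL)⟩,
    ⟨100, by norm_num, fun n ε hn hε hε4 => ?_⟩⟩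
  obtain ⟨S, hL, huses, hsteps⟩ := exists_learnsPauli hn hε hε4
  refine ⟨S, hL, huses, hsteps.trans ?_⟩
  have hlog : 1 / 2 ≤ Real.log ((2 : ℝ) ^ n) := by
    rw [Real.log_pow]
    have h1 : (1 : ℝ) ≤ n := by exact_mod_cast hn
    have h2 := Real.log_two_gt_d9
    nlinarith
  have hd : (0 : ℝ) ≤ 100 * (2 ^ n) ^ 3 := by positivity
  refine div_le_div_of_nonneg_right ?_ (by positivity)
  calc 50 * ((2 : ℝ) ^ n) ^ 3 = 100 * (2 ^ n) ^ 3 * (1 / 2) := by ring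
    _ ≤ _ := mul_le_mul_of_nonneg_left hlog hd
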